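/- Let $\Sigma=\{0,1\}$. For a nondeterministic polynomial-time Turing machine $N$ (every computation path on input $x$ halts within $p(|x|)$ steps, for a fixed polynomial $p$) and $x\in\Sigma^*$, let $\#\mathrm{acc}_N(x)$ be the number of accepting computation paths of $N$ on input $x$. FewP is the class of languages $L\subseteq\Sigma^*$ for which there are a nondeterministic polynomial-time Turing machine $N$ and a polynomial $q$ such that, for every $x\in\Sigma^*$, $\#\mathrm{acc}_N(x)\le q(|x|)$, and $x\in L$ if and only if $\#\mathrm{acc}_N(x)>0$. For a set $S$ of positive integers, $\mathrm{RC}_S$ is the class of languages $L\subseteq\Sigma^*$ for which there is a nondeterministic polynomial-time Turing machine $N$ such that, for every $x\in\Sigma^*$, $x\in L$ implies $\#\mathrm{acc}_N(x)\in S$, and $x\notin L$ implies $\#\mathrm{acc}_N(x)=0$. A set $S$ of positive integers is non-gappy if $S\ne\emptyset$ and there is a constant $k>0$ such that for every $n\in S$ there is $m\in S$ with $m>n$ and $m/n\le k$. A set $L\subseteq\Sigma^*$ is P-printable if there is a deterministic polynomial-time Turing machine $M$ such that, for every integer $n\ge 0$, $M$ on input $0^n$ prints out the set $\{x\in L : |x|\le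 n\}$. A set of positive integers is P-printable if the set of the binary representations of its elements is. **Theorem.** Let $T$ be a set of positive integers that has a non-gappy, P-printable subset. Then $\mathrm{FewP}\subseteq\mathrm{RC}_T$. -/

import Mathlib

namespace CountingClasses

/-- A nondeterministic Turing machine over the input alphabet `{0,1}` (`Bool`), in the multi-stack
presentation that Mathlib uses for its deterministic machines `Turing.FinTM2` (a tape is a pair of
stacks, a stack is a tape whose head stays at its end). It differs from `Turing.FinTM2` in that each
label carries a finite list of statements, and one step executes one of them, chosen
nondeterministically; and in that it has no output stack, but accepting and rejecting states. -/
structure NTM where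
  /-- index type of the stacks -/
  K : Type
  [decEqK : DecidableEq K]
  [finiteK : Finite K]
  /-- the input stack -/
  k₀ : K
  /-- stack alphabets -/
  Γ : K → Type
  [finiteΓ : ∀ k, Finite (Γ k)]
  /-- the input symbols, as symbols of the input stack -/
  inputSymbol : Bool ↪ Γ k₀
  /-- labels -/
  Λ : Type
  [finiteΛ : Finite Λ]
  /-- the initial label -/
  main : Λ
  /-- internal states -/
  σ : Type
  [finiteσ : Finite σ]
  /-- the initial state -/
  initialState : σ
  /-- the program: the possible next statements at each label -/
  m : Λ → List (Turing.TM2.Stmt Γ Λ σ)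
  /-- the states in which a halted machine accepts -/
  accept : σ → Bool

namespace NTM

/-- Configurations; `l = none` is the halting label. -/
abbrev Cfg (N : NTM) : Type := Turing.TM2.Cfg N.Γ N.Λ N.σ

/-- The initial configuration: the input word is on the input stack, its first symbol on top, and
all other stacks are empty. -/
def init (N : NTM) (x : List Bool) : N.Cfg where
  l := some N.main
  var := N.initialState
  stk := letI := N.decEqK
    Function.update (fun _ => []) N.k₀ (x.map N.inputSymbol)

/-- The configuration after one step in which the `i`-th of the available statements is chosen;
`none` if the machine has halted or if there is no such statement. -/
def step (N : NTM) (i : ℕ) (c : N.Cfg) : Option N.Cfg :=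
  letI := N.decEqK
  match c.l with
  | none => none
  | some l => (N.m l)[i]?.map fun q => Turing.TM2.stepAux q c.var c.stk

/-- The configuration reached from `c` by the sequence `w` of nondeterministic choices; `none` if
`w` is not a possible sequence of choices. -/
def run (N : NTM) : List ℕ → N.Cfg → Option N.Cfg
  | [], c => some c
  | i :: w, c => (N.step i c).bind (N.run w)

/-- `w` is an accepting computation path on input `x`: following the choices `w` the machine goes
from the initial configuration to a halted configuration in an accepting state. -/
def IsAcceptingPath (N : NTM) (x : List Bool) (w : List ℕ) : Prop :=
  ∃ c, N.run w (N.init x) = some c ∧ c.l = none ∧ N.accept c.var = true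

/-- The number of accepting computation paths of `N` on input `x`. -/
noncomputable def numAcc (N : NTM) (x : List Bool) : ℕ :=
  {w | N.IsAcceptingPath x w}.ncard

/-- `N` runs in polynomial time: every (partial) computation path on `x`, accepting or not, has at
most `p(|x|)` steps. -/
def PolyTime (N : NTM) : Prop :=
  ∃ p : Polynomial ℕ, ∀ (x : List Bool) (w : List ℕ),
    N.run w (N.init x) ≠ none → w.length ≤ p.eval x.length

/-- There are finitely many computation paths of bounded length. -/
theorem finite_paths (N : NTM) (n : ℕ) (c : N.Cfg) :
    {w : List ℕ | w.length ≤ n ∧ N.run w c ≠ none}.Finite := by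
  induction n generalizing c with
  | zero =>
    refine (Set.finite_singleton ([] : List ℕ)).subset ?_
    rintro w ⟨hw, -⟩
    simpa using hw
  | succ n ih =>
    obtain ⟨l, v, S⟩ := c
    cases l with
    | none =>
      refine (Set.finite_singleton ([] : List ℕ)).subset ?_
      rintro (_ | ⟨i, w⟩) ⟨-, hw⟩
      · rfl
      · exact absurd (by simp [run, step]) hw
    | some l =>
      have hfin : (⋃ i ∈ Set.Iio (N.m l).length, ⋃ d ∈ {d | N.step i ⟨some l, v, S⟩ = some d},
          (List.cons i) '' {w : List ℕ | w.length ≤ n ∧ N.run w d ≠ none}).Finite := by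
        refine (Set.finite_Iio _).biUnion fun i _ => Set.Finite.biUnion ?_ fun d _ => (ih d).image _
        refine Set.Subsingleton.finite fun a ha b hb => ?_
        exact Option.some.inj ((Eq.symm ha).trans hb)
      refine (hfin.insert []).subset ?_
      rintro (_ | ⟨i, w⟩) ⟨hl, hw⟩
      · exact Set.mem_insert _ _
      · refine Set.mem_insert_of_mem _ ?_
        simp only [run] at hw
        obtain ⟨d, hd⟩ : ∃ d, N.step i ⟨some l, v, S⟩ = some d := by
          cases h : N.step i ⟨some l, v, S⟩ with
          | none => simp [h] at hw
          | some d => exact ⟨d, rfl⟩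
        have hi : i < (N.m l).length := by
          by_contra hi
          simp [step, List.getElem?_eq_none (not_lt.mp hi)] at hd
        simp only [Set.mem_iUnion]
        refine ⟨i, hi, d, hd, w, ⟨by simpa using hl, ?_⟩, rfl⟩
        simpa [hd] using hw

/-- For a polynomial-time machine the set counted by `numAcc` is finite. -/
theorem PolyTime.finite_acceptingPaths {N : NTM} (h : N.PolyTime) (x : List Bool) :
    {w | N.IsAcceptingPath x w}.Finite := by
  obtain ⟨p, hp⟩ := h
  refine (N.finite_paths (p.eval x.length) (N.init x)).subset ?_
  rintro w ⟨c, hc, -⟩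
  have : N.run w (N.init x) ≠ none := by simp [hc]
  exact ⟨hp x w this, this⟩

end NTM

/-- The restricted counting class `RC_S`. -/
def RC (S : Set ℕ) : Set (Language Bool) :=
  {L | ∃ N : NTM, N.PolyTime ∧
    ∀ x : List Bool, (x ∈ L → N.numAcc x ∈ S) ∧ (x ∉ L → N.numAcc x = 0)}

/-- The class `FewP`: languages of polynomial-time nondeterministic machines that have at most
polynomially many accepting paths on every input. -/
def FewP : Set (Language Bool) :=
  {L | ∃ N : NTM, N.PolyTime ∧ ∃ p : Polynomial ℕ,
    ∀ x : List Bool, N.numAcc x ≤ p.eval x.length ∧ (x ∈ L ↔ 0 < N.numAcc x)}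

/-- A set (of positive integers) is non-gappy if it is nonempty and, for some constant `k`, each of
its elements `n` is followed by a larger element that is at most `k` times as large. -/
def NonGappy (S : Set ℕ) : Prop :=
  S.Nonempty ∧ ∃ k : ℝ, 0 < k ∧ ∀ n ∈ S, ∃ m ∈ S, n < m ∧ (m : ℝ) / (n : ℝ) ≤ k

/-- The word `0ⁿ`. -/
def zeros (n : ℕ) : List Bool := List.replicate n false

/-- A list of words written out, each word followed by the delimiter `none`. -/
def printWords (ws : List (List Bool)) : List (Option Bool) :=
  ws.flatMap fun w => w.map some ++ [none]

/-- `L` is P-printable: some deterministic Turing machine (all of whose stack alphabets are finite)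
running in polynomial time prints, for every `n`, on input `0ⁿ` the words of `L` of length at most
`n`. The words may come in any order. -/
def PPrintable (L : Language Bool) : Prop :=
  ∃ f : ℕ → List (List Bool),
    (∀ n x, x ∈ f n ↔ x ∈ L ∧ x.length ≤ n) ∧
    ∃ M : Turing.TM2ComputableInPolyTime zeros printWords f, ∀ k, Finite (M.tm.Γ k)

/-- The binary representation of `n`, most significant digit first, without leading zeros. -/
def binary (n : ℕ) : List Bool := n.bits.reverse

/-- A set of natural numbers as a set of words, each number being written in binary. -/
def binaryLanguage (S : Set ℕ) : Language Bool := {x | ∃ n ∈ S, binary n = x}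

end CountingClasses

/-!
The machine `N` of a language in `FewP` has at most `q` accepting paths on the given input, where
`q` is polynomial in the length of the input. A new machine guesses, for every `k`, each set of `k`
accepting paths of `N` (in increasing order, so that each set is guessed once), and then branches
into `c k` accepting paths, for suitable coefficients `c 0 = 0, c 1, c 2, …`. If `N` has `m`
accepting paths, then the new machine has `∑ k, m.choose k * c k` of them, which is
`binomSum c m 0`. This is `0` for `m = 0`, and for `m = k + 1` it is the sum of a number
`nextBase (stage κ ns k)`, which depends on `c 0, …, c k` only, and of `c (k + 1)`. So the
coefficients can be chosen one after another, such that the value for each positive `m ≤ q` is an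
element of the given set `S`.

That the elements of `S` can be chosen without losing polynomial time is due to the two hypotheses
on `S`. It is non-gappy, so each number is exceeded by elements of `S` with at most `κ` more binary
digits (`NonGappy.exists_size`). If an element is chosen in this way for each `m`, then at most
`q + κ` digits are added in each step, since `nextBase (stage κ ns k)` is at most `k + 1` times the
value for `m = k` (`nextBase_stage_le`). All the numbers have therefore at most `q * (q + κ)` digits
(`binomSum_coeff_mem`). And since `S` is P-printable, all its elements up to this size can be listed
at the start. The new machine does not compute binomial coefficients: it keeps one antidiagonal of
the difference table of the values `binomSum c m 0`, `m = 0, 1, 2, …`, and obtains the next one by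
running sums (`stage`, `map_stage`).

The rest of the proof constructs this machine. Its code is composed from pieces (`Prog`) by
sequence, loops and nondeterministic choice. `Prog.Counts` states that a piece has a given number of
accepting paths, in terms of the numbers of accepting paths of what follows at its exit; a
deterministic run (`Prog.Runs`, `Exec`) leaves this number unchanged. The stacks of the machine are
the fields of `Env`. The pieces are specified by `exists_exec_print` for the list of elements of
`S`, `counts_branchOut` for branching into a given number of paths, `counts_guess` for guessing the
next accepting path of `N`, and `exec_advance` for the next coefficient; `counts_mainLoop` puts them
together, by induction on the number of accepting paths greater than the one guessed last.
-/

namespace CountingClasses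

open Turing Turing.TM2

/-! ### Programs with one entry and one exit -/

section Programs

variable {K : Type} {Γ : K → Type} {σ Λ Λ' : Type}

/-- Replace the jump targets of a statement. -/
def relabel (f : Λ → Λ') : Stmt Γ Λ σ → Stmt Γ Λ' σ
  | .push k g q => .push k g (relabel f q)
  | .peek k g q => .peek k g (relabel f q)
  | .pop k g q => .pop k g (relabel f q)
  | .load g q => .load g (relabel f q)
  | .branch g q₁ q₂ => .branch g (relabel f q₁) (relabel f q₂)
  | .goto l => .goto (f ∘ l)
  | .halt => .halt

variable [DecidableEq K]

theorem stepAux_relabel (f : Λ → Λ') (q : Stmt Γ Λ σ) (v : σ) (S : ∀ k, List (Γ k)) :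
    stepAux (relabel f q) v S =
      ⟨(stepAux q v S).l.map f, (stepAux q v S).var, (stepAux q v S).stk⟩ := by
  induction q generalizing v S with
  | branch g q₁ q₂ ih₁ ih₂ => cases h : g v <;> simp [relabel, h, ih₁, ih₂]
  | _ => simp_all [relabel]

/-- A piece of nondeterministic machine code. A jump to `none` leaves the piece; the statement
`halt` stops the whole machine. As for `NTM`, one step at a label executes one statement of the
list found there. -/
structure Prog (Γ : K → Type) (σ : Type) where
  /-- labels -/
  L : Type
  [finiteL : Finite L]
  /-- the label at which execution starts -/
  entry : L
  /-- the possible next statements at each label -/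
  code : L → List (Stmt Γ (Option L) σ)

attribute [instance] Prog.finiteL

namespace Prog

/-- `P.Counts A Φ c t n`: every path from the configuration `c` of `P` has at most `t` steps, and
exactly `n` of them are accepting. A path ends when the machine halts, and then it accepts if `A`
holds of its state. For a path that leaves `P`, the postcondition `Φ` says which time bounds and
which numbers of accepting continuations may be claimed for the state and the stacks at the exit. -/
inductive Counts (P : Prog Γ σ) (A : σ → Bool)
    (Φ : σ → (∀ k, List (Γ k)) → ℕ → ℕ → Prop) : Cfg Γ (Option P.L) σ → ℕ → ℕ → Prop
  | exit {v S t n} : Φ v S t n → Counts P A Φ ⟨some none, v, S⟩ t n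
  | halt {v S} : Counts P A Φ ⟨none, v, S⟩ 0 (A v).toNat
  | step {l v S t} (ns : ℕ → ℕ) :
      (∀ i (h : i < (P.code l).length), Counts P A Φ (stepAux (P.code l)[i] v S) t (ns i)) →
      Counts P A Φ ⟨some (some l), v, S⟩ (t + 1) (∑ i ∈ Finset.range (P.code l).length, ns i)
  | mono {c t t' n} : Counts P A Φ c t n → t ≤ t' → Counts P A Φ c t' n

variable {P Q : Prog Γ σ} {A : σ → Bool} {Φ Ψ : σ → (∀ k, List (Γ k)) → ℕ → ℕ → Prop}

/-- `Counts` from the entry. -/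
def CountsFrom (P : Prog Γ σ) (A : σ → Bool) (Φ : σ → (∀ k, List (Γ k)) → ℕ → ℕ → Prop)
    (v : σ) (S : ∀ k, List (Γ k)) (t n : ℕ) : Prop :=
  P.Counts A Φ ⟨some (some P.entry), v, S⟩ t n

theorem Counts.post_mono {c : Cfg Γ (Option P.L) σ} {t n : ℕ} (h : P.Counts A Φ c t n)
    (hΦ : ∀ v S t n, Φ v S t n → Ψ v S t n) : P.Counts A Ψ c t n := by
  induction h with
  | exit h => exact .exit (hΦ _ _ _ _ h)
  | halt => exact .halt
  | step ns _ ih => exact .step ns ih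
  | mono _ hle ih => exact .mono ih hle

theorem Counts.step_one {l : P.L} {q : Stmt Γ (Option P.L) σ} {v : σ} {S : ∀ k, List (Γ k)}
    {t n : ℕ} (hq : P.code l = [q]) (h : P.Counts A Φ (stepAux q v S) t n) :
    P.Counts A Φ ⟨some (some l), v, S⟩ (t + 1) n := by
  have := Counts.step (P := P) (A := A) (Φ := Φ) (l := l) (v := v) (S := S) (t := t) (fun _ => n)
    (by simp only [hq]; intro i hi; simp only [List.length_singleton, Nat.lt_one_iff] at hi
        subst hi; simpa using h)
  simpa [hq] using this

theorem Counts.step_relabel {l : P.L} {f : Λ → Option P.L} {q : Stmt Γ Λ σ} {v v' : σ}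
    {S S' : ∀ k, List (Γ k)} {a : Λ} {t n : ℕ} (hl : P.code l = [relabel f q])
    (hq : stepAux q v S = ⟨some a, v', S'⟩) (h : P.Counts A Φ ⟨some (f a), v', S'⟩ t n) :
    P.Counts A Φ ⟨some (some l), v, S⟩ (t + 1) n := by
  refine Counts.step_one hl ?_
  rw [stepAux_relabel, hq]
  exact h

theorem Counts.step_two {l : P.L} {q₁ q₂ : Stmt Γ (Option P.L) σ} {v : σ} {S : ∀ k, List (Γ k)}
    {t n₁ n₂ : ℕ} (hq : P.code l = [q₁, q₂]) (h₁ : P.Counts A Φ (stepAux q₁ v S) t n₁)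
    (h₂ : P.Counts A Φ (stepAux q₂ v S) t n₂) :
    P.Counts A Φ ⟨some (some l), v, S⟩ (t + 1) (n₁ + n₂) := by
  have := Counts.step (P := P) (A := A) (Φ := Φ) (l := l) (v := v) (S := S) (t := t)
    (fun i => if i = 0 then n₁ else n₂)
    (by simp only [hq]; intro i hi
        have : i = 0 ∨ i = 1 := by simp at hi; omega
        rcases this with rfl | rfl
        · simpa using h₁
        · simpa using h₂)
  simpa [hq, Finset.sum_range_succ] using this

theorem Counts.step_three {l : P.L} {q₁ q₂ q₃ : Stmt Γ (Option P.L) σ} {v : σ}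
    {S : ∀ k, List (Γ k)} {t n₁ n₂ n₃ : ℕ} (hq : P.code l = [q₁, q₂, q₃])
    (h₁ : P.Counts A Φ (stepAux q₁ v S) t n₁) (h₂ : P.Counts A Φ (stepAux q₂ v S) t n₂)
    (h₃ : P.Counts A Φ (stepAux q₃ v S) t n₃) :
    P.Counts A Φ ⟨some (some l), v, S⟩ (t + 1) (n₁ + n₂ + n₃) := by
  have := Counts.step (P := P) (A := A) (Φ := Φ) (l := l) (v := v) (S := S) (t := t)
    (fun i => if i = 0 then n₁ else if i = 1 then n₂ else n₃)
    (by simp only [hq]; intro i hi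
        have : i = 0 ∨ i = 1 ∨ i = 2 := by simp at hi; omega
        rcases this with rfl | rfl | rfl
        · simpa using h₁
        · simpa using h₂
        · simpa using h₃)
  simpa [hq, Finset.sum_range_succ] using this

/-- Code that occurs in a larger program, with its exit connected to the label `ex`. -/
theorem Counts.embed (f : P.L → Q.L) (ex : Option Q.L)
    (hcode : ∀ l, Q.code (f l) = (P.code l).map (relabel fun o => o.elim ex (some ∘ f)))
    {c : Cfg Γ (Option P.L) σ} {t n : ℕ}
    (h : P.Counts A (fun v S t n => Q.Counts A Φ ⟨some ex, v, S⟩ t n) c t n) :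
    Q.Counts A Φ ⟨c.l.map fun o => o.elim ex (some ∘ f), c.var, c.stk⟩ t n := by
  induction h with
  | exit h => exact h
  | halt => exact .halt
  | @step l v S t ns _ ih =>
    have := Counts.step (P := Q) (A := A) (Φ := Φ) (l := f l) (v := v) (S := S) (t := t) ns
      (fun i hi => by
        have hi' : i < (P.code l).length := by simpa [hcode] using hi
        simpa [hcode, stepAux_relabel] using ih i hi')
    simpa [hcode] using this
  | mono _ hle ih => exact .mono ih hle

/-- A deterministic run of `P` from its entry to its exit, in at most `T` steps. -/
def Runs (P : Prog Γ σ) (v : σ) (S : ∀ k, List (Γ k)) (v' : σ) (S' : ∀ k, List (Γ k))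
    (T : ℕ) : Prop :=
  ∀ A Φ t n, Φ v' S' t n → P.CountsFrom A Φ v S (t + T) n

theorem Runs.mono {v v' : σ} {S S' : ∀ k, List (Γ k)} {T T' : ℕ} (h : P.Runs v S v' S' T)
    (hT : T ≤ T') : P.Runs v S v' S' T' :=
  fun A Φ t n hΦ => .mono (h A Φ t n hΦ) (by omega)

/-! #### Composition -/

/-- Run `P`, then `Q`. -/
def seq (P Q : Prog Γ σ) : Prog Γ σ where
  L := P.L ⊕ Q.L
  entry := .inl P.entry
  code := Sum.elim
    (fun l => (P.code l).map (relabel fun o => o.elim (some (.inr Q.entry)) (some ∘ .inl)))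
    (fun l => (Q.code l).map (relabel fun o => o.elim none (some ∘ .inr)))

theorem CountsFrom.seq {v : σ} {S : ∀ k, List (Γ k)} {t n : ℕ}
    (h : P.CountsFrom A (Q.CountsFrom A Φ) v S t n) : (P.seq Q).CountsFrom A Φ v S t n := by
  refine Counts.embed (Q := P.seq Q) (Φ := Φ) (.inl : P.L → P.L ⊕ Q.L) (some (.inr Q.entry))
    (fun _ => rfl) (Counts.post_mono h fun v S t n hQ => ?_)
  exact Counts.embed (Q := P.seq Q) (Φ := Φ) (.inr : Q.L → P.L ⊕ Q.L) none
    (fun _ => rfl) (Counts.post_mono hQ fun v S t n h => .exit h)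

theorem Runs.countsFrom_seq {v v' : σ} {S S' : ∀ k, List (Γ k)} {T t n : ℕ}
    (h : P.Runs v S v' S' T) (hQ : Q.CountsFrom A Φ v' S' t n) :
    (P.seq Q).CountsFrom A Φ v S (t + T) n :=
  CountsFrom.seq (h A _ t n hQ)

theorem Runs.seq {v v' v'' : σ} {S S' S'' : ∀ k, List (Γ k)} {T T' : ℕ}
    (h : P.Runs v S v' S' T) (h' : Q.Runs v' S' v'' S'' T') :
    (P.seq Q).Runs v S v'' S'' (T + T') :=
  fun A Φ t n hΦ => .mono (h.countsFrom_seq (h' A Φ t n hΦ)) (by omega)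

/-- Run the statement `q`; if it jumps to `true`, run `P` and repeat, otherwise leave. -/
def loop (q : Stmt Γ Bool σ) (P : Prog Γ σ) : Prog Γ σ where
  L := Option P.L
  entry := none
  code
    | none => [relabel (fun b => if b then some (some P.entry) else none) q]
    | some l => (P.code l).map (relabel fun o => o.elim (some none) (some ∘ some))

theorem CountsFrom.loop {q : Stmt Γ Bool σ} {v v' : σ} {S S' : ∀ k, List (Γ k)} {t n : ℕ}
    (hq : stepAux q v S = ⟨some true, v', S'⟩)
    (h : P.CountsFrom A ((P.loop q).CountsFrom A Φ) v' S' t n) :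
    (P.loop q).CountsFrom A Φ v S (t + 1) n :=
  Counts.step_relabel (P := P.loop q) rfl hq
    (Counts.embed (Q := P.loop q) (Φ := Φ) (some : P.L → Option P.L) (some none)
      (fun _ => rfl) h)

theorem Runs.loop_exit {q : Stmt Γ Bool σ} {v v' : σ} {S S' : ∀ k, List (Γ k)}
    (hq : stepAux q v S = ⟨some false, v', S'⟩) : (P.loop q).Runs v S v' S' 1 :=
  fun _ _ _ _ h => Counts.step_relabel (P := P.loop q) rfl hq (.exit h)

theorem Runs.loop {q : Stmt Γ Bool σ} {v v' v'' w : σ} {S S' S'' R : ∀ k, List (Γ k)} {T T' : ℕ}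
    (hq : stepAux q v S = ⟨some true, v', S'⟩) (h : P.Runs v' S' v'' S'' T)
    (h' : (P.loop q).Runs v'' S'' w R T') : (P.loop q).Runs v S w R (T' + T + 1) :=
  fun A Φ t n hΦ => .mono (CountsFrom.loop hq (h A _ (t + T') n (h' A Φ t n hΦ))) (by omega)

/-- A single label. Each statement jumps to `true` to repeat, or to `false` to leave. -/
def block (qs : List (Stmt Γ Bool σ)) : Prog Γ σ where
  L := Unit
  entry := ()
  code _ := qs.map (relabel fun b => if b then some () else none)

theorem Runs.block_exit {q : Stmt Γ Bool σ} {v v' : σ} {S S' : ∀ k, List (Γ k)}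
    (hq : stepAux q v S = ⟨some false, v', S'⟩) : (block [q]).Runs v S v' S' 1 :=
  fun _ _ _ _ h => Counts.step_relabel (P := block [q]) rfl hq (.exit h)

theorem Runs.block_step {q : Stmt Γ Bool σ} {v v' w : σ} {S S' R : ∀ k, List (Γ k)} {T : ℕ}
    (hq : stepAux q v S = ⟨some true, v', S'⟩) (h : (block [q]).Runs v' S' w R T) :
    (block [q]).Runs v S w R (T + 1) :=
  fun A Φ t n hΦ => Counts.step_relabel (P := block [q]) rfl hq (h A Φ t n hΦ)

/-- Run `P` or `Q`, chosen nondeterministically. -/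
def choose (P Q : Prog Γ σ) : Prog Γ σ where
  L := Option (P.L ⊕ Q.L)
  entry := none
  code
    | none => [.goto fun _ => some (some (.inl P.entry)), .goto fun _ => some (some (.inr Q.entry))]
    | some (.inl l) => (P.code l).map (relabel fun o => o.elim none (some ∘ some ∘ .inl))
    | some (.inr l) => (Q.code l).map (relabel fun o => o.elim none (some ∘ some ∘ .inr))

theorem CountsFrom.choose {v : σ} {S : ∀ k, List (Γ k)} {t n m : ℕ}
    (hP : P.CountsFrom A Φ v S t n) (hQ : Q.CountsFrom A Φ v S t m) :
    (P.choose Q).CountsFrom A Φ v S (t + 1) (n + m) := by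
  refine Counts.step_two (P := P.choose Q) rfl ?_ ?_
  · exact Counts.embed (Q := P.choose Q) (Φ := Φ) (some ∘ .inl : P.L → Option (P.L ⊕ Q.L)) none
      (fun _ => rfl) (Counts.post_mono hP fun v S t n h => .exit h)
  · exact Counts.embed (Q := P.choose Q) (Φ := Φ) (some ∘ .inr : Q.L → Option (P.L ⊕ Q.L)) none
      (fun _ => rfl) (Counts.post_mono hQ fun v S t n h => .exit h)

end Prog

end Programs

/-! ### Programs as machines -/

namespace NTM

variable {N : NTM}

/-- Every path from `c` has at most `t` steps, and exactly `n` paths from `c` are accepting. -/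
def HasCount (N : NTM) (c : N.Cfg) (t n : ℕ) : Prop :=
  (∀ w, N.run w c ≠ none → w.length ≤ t) ∧ ∃ F : Finset (List ℕ),
    (∀ w, w ∈ F ↔ ∃ d, N.run w c = some d ∧ d.l = none ∧ N.accept d.var = true) ∧ F.card = n

theorem run_cons {l : N.Λ} {v : N.σ} {S : ∀ k, List (N.Γ k)} {i : ℕ} (hi : i < (N.m l).length)
    (w : List ℕ) : N.run (i :: w) ⟨some l, v, S⟩ =
      N.run w (letI := N.decEqK; stepAux (N.m l)[i] v S) := by
  simp [run, step, List.getElem?_eq_getElem hi]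

theorem run_cons_of_le {l : N.Λ} {v : N.σ} {S : ∀ k, List (N.Γ k)} {i : ℕ}
    (hi : (N.m l).length ≤ i) (w : List ℕ) : N.run (i :: w) ⟨some l, v, S⟩ = none := by
  simp [run, step, List.getElem?_eq_none hi]

theorem run_cons_none {v : N.σ} {S : ∀ k, List (N.Γ k)} (i : ℕ) (w : List ℕ) :
    N.run (i :: w) ⟨none, v, S⟩ = none := by
  simp [run, step]

theorem HasCount.halt (v : N.σ) (S : ∀ k, List (N.Γ k)) :
    N.HasCount ⟨none, v, S⟩ 0 (N.accept v).toNat := by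
  refine ⟨?_, if N.accept v then {[]} else ∅, ?_, ?_⟩
  · rintro (_ | ⟨i, w⟩) h
    · rfl
    · exact absurd (run_cons_none i w) h
  · rintro (_ | ⟨i, w⟩)
    · cases h : N.accept v <;> simp [run, h]
    · cases h : N.accept v <;> simp [run_cons_none]
  · cases h : N.accept v <;> simp

theorem HasCount.step {l : N.Λ} {v : N.σ} {S : ∀ k, List (N.Γ k)} {t : ℕ} (ns : ℕ → ℕ)
    (h : ∀ i (hi : i < (N.m l).length),
      N.HasCount (letI := N.decEqK; stepAux (N.m l)[i] v S) t (ns i)) :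
    N.HasCount ⟨some l, v, S⟩ (t + 1) (∑ i ∈ Finset.range (N.m l).length, ns i) := by
  have h' := fun i : Fin (N.m l).length => h i i.2
  choose h₁ F hF hc using h'
  refine ⟨?_, Finset.univ.biUnion fun i => (F i).map ⟨List.cons (i : ℕ), List.cons_injective⟩,
    ?_, ?_⟩
  · rintro (_ | ⟨i, w⟩) hw
    · simp
    · by_cases hi : i < (N.m l).length
      · rw [run_cons hi] at hw
        simpa using h₁ ⟨i, hi⟩ w hw
      · exact absurd (run_cons_of_le (not_lt.mp hi) w) hw
  · rintro (_ | ⟨i, w⟩)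
    · simp [run]
    · simp only [Finset.mem_biUnion, Finset.mem_univ, true_and, Finset.mem_map,
        Function.Embedding.coeFn_mk, List.cons.injEq]
      by_cases hi : i < (N.m l).length
      · rw [run_cons hi]
        refine Iff.trans ?_ (hF ⟨i, hi⟩ w)
        constructor
        · rintro ⟨j, a, ha, hj, rfl⟩
          obtain rfl : j = ⟨i, hi⟩ := Fin.ext hj
          exact ha
        · exact fun h => ⟨_, w, h, rfl, rfl⟩
      · rw [run_cons_of_le (not_lt.mp hi)]
        constructor
        · rintro ⟨j, a, ha, hj, rfl⟩
          exact absurd j.2 (by omega)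
        · rintro ⟨d, ⟨⟩, -⟩
  · rw [Finset.card_biUnion]
    · rw [← Fin.sum_univ_eq_sum_range]
      simp [hc]
    · intro i _ j _ hij
      rw [Function.onFun, Finset.disjoint_left]
      simp only [Finset.mem_map, Function.Embedding.coeFn_mk, not_exists, not_and]
      rintro _ ⟨a, _, rfl⟩ b _ h
      exact hij (Fin.ext (List.cons.inj h).1.symm)

theorem HasCount.mono {c : N.Cfg} {t t' n : ℕ} (h : N.HasCount c t n) (ht : t ≤ t') :
    N.HasCount c t' n :=
  ⟨fun w hw => (h.1 w hw).trans ht, h.2⟩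

theorem HasCount.numAcc {x : List Bool} {t n : ℕ} (h : N.HasCount (N.init x) t n) :
    N.numAcc x = n := by
  obtain ⟨-, F, hF, rfl⟩ := h
  rw [NTM.numAcc, ← Set.ncard_coe_finset]
  exact congrArg Set.ncard (Set.ext fun w => (hF w).symm)

end NTM

section ToNTM

variable {K : Type} [DecidableEq K] [Finite K] {Γ : K → Type} [∀ k, Finite (Γ k)] {σ : Type}
  [Finite σ]

/-- The machine that runs `P` and stops without accepting at the exit of `P`. -/
def Prog.toNTM (P : Prog Γ σ) (k₀ : K) (inp : Bool ↪ Γ k₀) (v₀ : σ) (A : σ → Bool) : NTM where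
  K := K
  k₀ := k₀
  Γ := Γ
  inputSymbol := inp
  Λ := Option P.L
  main := some P.entry
  σ := σ
  initialState := v₀
  m o := o.elim [] P.code
  accept := A

theorem Prog.Counts.hasCount {P : Prog Γ σ} {k₀ : K} {inp : Bool ↪ Γ k₀} {v₀ : σ}
    {A : σ → Bool} {c : Cfg Γ (Option P.L) σ} {t n : ℕ}
    (h : P.Counts A (fun _ _ _ _ => False) c t n) : (P.toNTM k₀ inp v₀ A).HasCount c t n := by
  induction h with
  | exit h => exact h.elim
  | halt => exact NTM.HasCount.halt (N := P.toNTM k₀ inp v₀ A) _ _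
  | step ns _ ih => exact NTM.HasCount.step (N := P.toNTM k₀ inp v₀ A) ns ih
  | mono _ hle ih => exact ih.mono hle

end ToNTM

/-! ### Choosing the numbers of accepting paths -/

/-- The inverse of iterated differencing: `binomSum c m i = ∑ j, m.choose j * c (i + j)`. -/
def binomSum (c : ℕ → ℕ) : ℕ → ℕ → ℕ
  | 0, i => c i
  | m + 1, i => binomSum c m i + binomSum c m (i + 1)

theorem binomSum_eq_add_sum (c : ℕ → ℕ) (m i : ℕ) :
    binomSum c m i = c i + ∑ j ∈ Finset.range m, binomSum c j (i + 1) := by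
  induction m with
  | zero => simp [binomSum]
  | succ m ih => rw [Finset.sum_range_succ, ← add_assoc, ← ih, binomSum]

theorem binomSum_le (c : ℕ → ℕ) (p j : ℕ) : binomSum c p j ≤ binomSum c (p + j) 0 := by
  induction j generalizing p with
  | zero => rfl
  | succ j ih =>
    calc binomSum c p (j + 1) ≤ binomSum c (p + 1) j := by rw [binomSum]; omega
      _ ≤ binomSum c (p + 1 + j) 0 := ih _
      _ = _ := by rw [show p + 1 + j = p + (j + 1) by omega]

theorem binomSum_succ_sub (c : ℕ → ℕ) {p k : ℕ} (h : p ≤ k) :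
    binomSum c (p + 1) (k - p) =
      ∑ r ∈ Finset.range (p + 1), binomSum c r (k - r) + c (k + 1) := by
  induction p with
  | zero => simp [binomSum]
  | succ p ih =>
    have ih := ih (by omega)
    rw [Finset.sum_range_succ, add_right_comm (Finset.sum _ _), ← ih, binomSum,
      show k - (p + 1) + 1 = k - p by omega, add_comm]

theorem sum_card_filter_lt {α : Type*} [LinearOrder α] (B : Finset α) (f : ℕ → ℕ) :
    ∑ w ∈ B, f (B.filter (w < ·)).card = ∑ j ∈ Finset.range B.card, f j := by
  induction B using Finset.induction_on_min with
  | empty => simp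
  | insert a B ha ih =>
    have haB : a ∉ B := fun h => lt_irrefl _ (ha a h)
    rw [Finset.sum_insert haB, Finset.card_insert_of_notMem haB, Finset.sum_range_succ, ← ih,
      add_comm]
    congr 1
    · refine Finset.sum_congr rfl fun w hw => ?_
      rw [Finset.filter_insert, if_neg (not_lt_of_gt (ha w hw))]
    · rw [Finset.filter_insert, if_neg (lt_irrefl a), Finset.filter_true_of_mem ha]

/-- The running sums `acc + (l₀ + c)`, `acc + (l₀ + c) + (l₁ + c)`, …. -/
def runningSums (c : ℕ) : ℕ → List ℕ → List ℕ
  | _, [] => []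
  | acc, d :: l => (acc + d + c) :: runningSums c (acc + d + c) l

theorem runningSums_eq {c : ℕ} {g : ℕ → ℕ} {l : List ℕ} {n : ℕ} (acc : ℕ)
    (h : l.map (· + c) = (List.range n).map g) :
    runningSums c acc l =
      (List.range n).map fun p => acc + ∑ r ∈ Finset.range (p + 1), g r := by
  induction l generalizing acc g n with
  | nil =>
    have hn : n = 0 := by simpa using h.symm
    simp [hn, runningSums]
  | cons d l ih =>
    obtain _ | n := n
    · simp at h
    · simp only [List.range_succ_eq_map, List.map_cons, List.map_map, List.cons.injEq,
        runningSums] at h ⊢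
      refine ⟨by simp [← h.1, add_assoc], ?_⟩
      rw [ih _ h.2]
      refine List.map_congr_left fun p _ => ?_
      rw [Function.comp, Finset.sum_range_succ' _ (p + 1), ← h.1]
      simp only [Function.comp, Nat.succ_eq_add_one]
      omega

theorem length_runningSums (c acc : ℕ) (l : List ℕ) : (runningSums c acc l).length = l.length := by
  induction l generalizing acc with
  | nil => rfl
  | cons d l ih => simp [runningSums, ih]

section Stage

/-- The smallest number of accepting paths that the next stage can have: the value for which the
next coefficient is `0`. -/
def nextBase (s : List ℕ × ℕ) : ℕ := s.1.sum + s.2 * (s.1.length + 1)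

/-- The first number in `ns` that has more binary digits than `b`, but at most `κ` more. -/
def pick (κ : ℕ) (ns : List ℕ) (b : ℕ) : ℕ :=
  (ns.find? fun a => decide (b.size < a.size ∧ a.size ≤ b.size + κ)).getD 0

variable (κ : ℕ) (ns : List ℕ)

/-- The tables of the machine after `k` guessed paths. The second component is the coefficient
`c k`. Adding it to the entries of the first component gives the antidiagonal
`binomSum c (p + 1) (k - 1 - p)`, `p < k`, of the difference table. -/
def stage : ℕ → List ℕ × ℕ
  | 0 => ([], 0)
  | k + 1 => (runningSums (stage k).2 0 (0 :: (stage k).1),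
      pick κ ns (nextBase (stage k)) - nextBase (stage k))

/-- The number of accepting paths that is added by each set of `k` accepting paths of the simulated
machine. -/
def coeff (k : ℕ) : ℕ := (stage κ ns k).2

theorem length_stage (k : ℕ) : (stage κ ns k).1.length = k := by
  induction k with
  | zero => rfl
  | succ k ih => simp [stage, length_runningSums, ih]

theorem map_stage (k : ℕ) : (0 :: (stage κ ns k).1).map (· + coeff κ ns k) =
    (List.range (k + 1)).map fun p => binomSum (coeff κ ns) p (k - p) := by
  induction k with
  | zero => simp [stage, binomSum]
  | succ k ih =>
    rw [stage, show (stage κ ns k).2 = coeff κ ns k from rfl, runningSums_eq 0 ih,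
      List.range_succ_eq_map (n := k + 1)]
    simp only [List.map_cons, List.map_map, Nat.zero_add, List.cons.injEq]
    refine ⟨rfl, List.map_congr_left fun p hp => ?_⟩
    have hp : p ≤ k := by simpa [Nat.lt_succ_iff] using hp
    simp only [Function.comp, Nat.succ_eq_add_one]
    rw [show k + 1 - (p + 1) = k - p by omega, binomSum_succ_sub _ hp]

theorem nextBase_stage (k : ℕ) : nextBase (stage κ ns k) =
    ∑ p ∈ Finset.range (k + 1), binomSum (coeff κ ns) p (k - p) := by
  have h := congrArg List.sum (map_stage κ ns k)
  rw [List.sum_map_add] at h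
  have hr : ∀ (f : ℕ → ℕ) n, ((List.range n).map f).sum = ∑ p ∈ Finset.range n, f p :=
    fun f n => rfl
  rw [← hr, ← h]
  simp only [nextBase, coeff, List.map_id', List.map_const', List.sum_replicate, List.sum_cons,
    List.length_cons, smul_eq_mul]
  ring

theorem binomSum_coeff_succ (k : ℕ) : binomSum (coeff κ ns) (k + 1) 0 =
    nextBase (stage κ ns k) + coeff κ ns (k + 1) := by
  have := binomSum_succ_sub (coeff κ ns) (le_refl k)
  rwa [Nat.sub_self, ← nextBase_stage] at this

theorem nextBase_stage_le (k : ℕ) :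
    nextBase (stage κ ns k) ≤ (k + 1) * binomSum (coeff κ ns) k 0 := by
  rw [nextBase_stage]
  refine (Finset.sum_le_card_nsmul _ _ (binomSum (coeff κ ns) k 0) fun p hp => ?_).trans (by simp)
  have hp : p ≤ k := by simpa [Nat.lt_succ_iff] using hp
  simpa [hp] using binomSum_le (coeff κ ns) p (k - p)

theorem stage_le {k d : ℕ} (hd : d ∈ 0 :: (stage κ ns k).1) :
    d + coeff κ ns k ≤ binomSum (coeff κ ns) k 0 := by
  have := List.mem_map_of_mem (f := (· + coeff κ ns k)) hd
  rw [map_stage] at this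
  obtain ⟨p, hp, h⟩ := List.mem_map.mp this
  have hp : p ≤ k := by simpa [Nat.lt_succ_iff] using hp
  rw [← h]
  simpa [hp] using binomSum_le (coeff κ ns) p (k - p)

variable {κ ns}

/-- Each value `k` of the path count of the simulated machine gives a value in `S`. -/
theorem binomSum_coeff_mem {S : Set ℕ} {q : ℕ}
    (hκ : ∀ b : ℕ, ∃ a ∈ S, b.size < a.size ∧ a.size ≤ b.size + κ)
    (hns : ∀ a, a ∈ ns ↔ a ∈ S ∧ a.size ≤ q * (q + κ)) (k : ℕ) (hk : k ≤ q) :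
    (binomSum (coeff κ ns) k 0).size ≤ k * (q + κ) ∧
      ∀ j, k = j + 1 → ∃ a ∈ S, binomSum (coeff κ ns) k 0 = a ∧
        ns.find? (fun a => decide ((nextBase (stage κ ns j)).size < a.size ∧
          a.size ≤ (nextBase (stage κ ns j)).size + κ)) = some a := by
  induction k with
  | zero => simp [binomSum, coeff, stage]
  | succ k ih =>
    have ih := (ih (by omega)).1
    set b := nextBase (stage κ ns k) with hb
    -- The factor `k + 1 ≤ q < 2 ^ q` adds at most `q` digits.
    have hbs : b.size ≤ q + k * (q + κ) := by
      have h1 : b < 2 ^ (q + k * (q + κ)) := by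
        refine (nextBase_stage_le κ ns k).trans_lt ?_
        rw [pow_add]
        refine Nat.mul_lt_mul_of_le_of_lt ?_ (Nat.size_le.mp ih) (by positivity)
        exact hk.trans Nat.lt_two_pow_self.le
      exact Nat.size_le.mpr h1
    have hbt : b.size + κ ≤ (k + 1) * (q + κ) := by rw [Nat.add_mul, Nat.one_mul]; omega
    obtain ⟨a', ha'S, ha'⟩ := hκ b
    have ha'ns : a' ∈ ns := (hns a').mpr
      ⟨ha'S, (ha'.2.trans hbt).trans (Nat.mul_le_mul_right _ hk)⟩
    obtain ⟨a, ha⟩ : ∃ a, ns.find? (fun a => decide (b.size < a.size ∧ a.size ≤ b.size + κ)) =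
        some a := Option.isSome_iff_exists.mp (List.find?_isSome.mpr ⟨a', ha'ns, by simpa using ha'⟩)
    have hpick : pick κ ns b = a := by rw [pick, ha]; rfl
    have hw : b.size < a.size ∧ a.size ≤ b.size + κ := by simpa using List.find?_some ha
    have hmem := List.mem_of_find?_eq_some ha
    have hba : b ≤ a := by
      by_contra hlt
      exact absurd (Nat.size_le_size (not_le.mp hlt).le) (not_le.mpr hw.1)
    have hval : binomSum (coeff κ ns) (k + 1) 0 = a := by
      rw [binomSum_coeff_succ, coeff, stage, ← hb, hpick]
      omega
    refine ⟨by rw [hval]; omega, ?_⟩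
    rintro j ⟨⟩
    exact ⟨a, ((hns a).mp hmem).1, hval, ha⟩

end Stage

/-- A non-gappy set of positive numbers has elements with a few more digits than any given
number. -/
theorem NonGappy.exists_size {S : Set ℕ} (hS : NonGappy S) (h0 : ∀ n ∈ S, 0 < n) :
    ∃ κ, ∀ b : ℕ, ∃ a ∈ S, b.size < a.size ∧ a.size ≤ b.size + κ := by
  obtain ⟨⟨m₀, hm₀⟩, k, hk0, hk⟩ := hS
  refine ⟨max m₀.size ⌈k⌉₊.size, fun b => ?_⟩
  classical
  -- Either the least power of two above `b` is at most `m₀`, or some element of `S` is below it and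
  -- the successor of the largest such element will do.
  by_cases hm : 2 ^ b.size ≤ m₀
  · exact ⟨m₀, hm₀, Nat.lt_size.mpr hm, by omega⟩
  · set B := (Finset.range (2 ^ b.size)).filter (· ∈ S) with hB
    have hBne : B.Nonempty := ⟨m₀, by simp [hB, hm₀]; omega⟩
    have hmax := B.max'_mem hBne
    set n := B.max' hBne with hn
    have hn' : n < 2 ^ b.size ∧ n ∈ S := by simpa [hB] using hmax
    obtain ⟨m, hmS, hnm, hmk⟩ := hk n hn'.2
    have hm' : 2 ^ b.size ≤ m := by
      by_contra hlt
      have : m ∈ B := by simp [hB, hmS]; omega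
      exact absurd (B.le_max' m this) (not_le.mpr hnm)
    refine ⟨m, hmS, Nat.lt_size.mpr hm', ?_⟩
    rw [Nat.size_le]
    have hnpos : (0 : ℝ) < n := by exact_mod_cast h0 n hn'.2
    rw [div_le_iff₀ hnpos] at hmk
    have h1 : m ≤ ⌈k⌉₊ * n := by
      have : (m : ℝ) ≤ (⌈k⌉₊ : ℝ) * n := hmk.trans (by gcongr; exact Nat.le_ceil k)
      exact_mod_cast this
    calc m ≤ ⌈k⌉₊ * n := h1
      _ < 2 ^ (max m₀.size ⌈k⌉₊.size) * 2 ^ b.size := by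
        refine Nat.mul_lt_mul_of_le_of_lt ?_ hn'.1 (by positivity)
        exact (Nat.lt_size_self _).le.trans (Nat.pow_le_pow_right (by norm_num) (le_max_right _ _))
      _ = _ := by rw [pow_add, mul_comm]

theorem length_binary (n : ℕ) : (binary n).length = n.size := by
  rw [binary, List.length_reverse, Nat.size_eq_bits_len]

/-- The output of a printer of `S` as a list of numbers. -/
theorem exists_map_binary {S : Set ℕ} {n : ℕ} {ws : List (List Bool)}
    (h : ∀ x, x ∈ ws ↔ x ∈ binaryLanguage S ∧ x.length ≤ n) :
    ∃ ns : List ℕ, ws = ns.map binary ∧ ∀ a, a ∈ ns ↔ a ∈ S ∧ a.size ≤ n := by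
  have hex : ∀ x ∈ ws, ∃ a ∈ S, binary a = x := fun x hx => ((h x).mp hx).1
  have hinj : Function.Injective binary := fun a b hab => by
    have h : a.bits = b.bits := List.reverse_injective hab
    rw [← Nat.ofDigits_digits 2 a, ← Nat.ofDigits_digits 2 b, Nat.digits_two_eq_bits,
      Nat.digits_two_eq_bits, h]
  choose! g hgS hg using hex
  have hmap : (ws.map g).map binary = ws := by
    rw [List.map_map]
    conv_rhs => rw [← List.map_id ws]
    exact List.map_congr_left fun x hx => hg x hx
  refine ⟨ws.map g, hmap.symm, fun a => ?_⟩
  constructor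
  · intro ha
    obtain ⟨x, hx, rfl⟩ := List.mem_map.mp ha
    refine ⟨hgS x hx, ?_⟩
    rw [← length_binary, hg x hx]
    exact ((h x).mp hx).2
  · rintro ⟨ha, hs⟩
    have hx : binary a ∈ ws := (h _).mpr ⟨⟨a, ha, rfl⟩, by rwa [length_binary]⟩
    exact List.mem_map.mpr ⟨_, hx, hinj (hg _ hx)⟩

/-! ### Growth of the stacks -/

section Growth

variable {K : Type} {Γ : K → Type} {σ Λ : Type}

/-- A bound for the number of symbols pushed by a statement. -/
def pushBound : Stmt Γ Λ σ → ℕ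
  | .push _ _ q => pushBound q + 1
  | .peek _ _ q => pushBound q
  | .pop _ _ q => pushBound q
  | .load _ q => pushBound q
  | .branch _ q₁ q₂ => pushBound q₁ + pushBound q₂
  | .goto _ => 0
  | .halt => 0

variable [DecidableEq K]

theorem length_stepAux_le (q : Stmt Γ Λ σ) (v : σ) (S : ∀ k, List (Γ k)) (k : K) :
    ((stepAux q v S).stk k).length ≤ (S k).length + pushBound q := by
  induction q generalizing v S with
  | push j g q ih =>
    rw [stepAux, pushBound]
    refine (ih v _).trans ?_
    by_cases h : k = j
    · subst h
      rw [Function.update_self, List.length_cons]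
      omega
    · simp [Function.update_of_ne h]
  | pop j g q ih =>
    rw [stepAux, pushBound]
    refine (ih _ _).trans ?_
    by_cases h : k = j
    · subst h; simp
    · simp [Function.update_of_ne h]
  | peek j g q ih => exact ih _ _
  | load g q ih => exact ih _ _
  | branch g q₁ q₂ ih₁ ih₂ =>
    rw [stepAux, pushBound]
    cases g v
    · exact (ih₂ v S).trans (by omega)
    · exact (ih₁ v S).trans (by omega)
  | goto l => simp [pushBound]
  | halt => simp [pushBound]

end Growth

namespace NTM

variable (N : NTM)

attribute [instance] NTM.decEqK NTM.finiteK NTM.finiteΓ NTM.finiteΛ NTM.finiteσ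

theorem exists_pushBound : ∃ C, ∀ l, ∀ q ∈ N.m l, pushBound q ≤ C := by
  obtain ⟨C, hC⟩ := (Set.finite_range fun l => ((N.m l).map pushBound).sum).bddAbove
  refine ⟨C, fun l q hq => le_trans ?_ (hC ⟨l, rfl⟩)⟩
  exact List.le_sum_of_mem (List.mem_map_of_mem hq)

theorem exists_length_le : ∃ B, ∀ l, (N.m l).length ≤ B := by
  obtain ⟨C, hC⟩ := (Set.finite_range fun l => (N.m l).length).bddAbove
  exact ⟨C, fun l => hC ⟨l, rfl⟩⟩

variable {N}

theorem length_run_le {C : ℕ} (hC : ∀ l, ∀ q ∈ N.m l, pushBound q ≤ C) {w : List ℕ} {c d : N.Cfg}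
    (h : N.run w c = some d) (k : N.K) :
    (d.stk k).length ≤ (c.stk k).length + C * w.length := by
  induction w generalizing c with
  | nil => cases h; simp
  | cons i w ih =>
    obtain ⟨_ | l, v, S⟩ := c
    · rw [run_cons_none] at h; cases h
    · by_cases hi : i < (N.m l).length
      · rw [run_cons hi] at h
        have h1 := ih h
        have h2 := length_stepAux_le (N.m l)[i] v S k
        have h3 := hC l _ (List.getElem_mem hi)
        have h4 : C * (i :: w).length = C * w.length + C := by simp [Nat.mul_add]
        simp only [h4]
        exact h1.trans (by omega)
      · rw [run_cons_of_le (not_lt.mp hi)] at h; cases h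

/-- A sum over accepting paths, split according to the first choice. -/
theorem sum_acceptingPaths {l : N.Λ} {v : N.σ} {S : ∀ k, List (N.Γ k)} {F : Finset (List ℕ)}
    (hF : ∀ w, w ∈ F ↔ ∃ d, N.run w ⟨some l, v, S⟩ = some d ∧ d.l = none ∧
      N.accept d.var = true) (h : List ℕ → ℕ) :
    ∑ w ∈ F, h w = ∑ i ∈ Finset.range (N.m l).length,
      ∑ w ∈ F.preimage (List.cons i) List.cons_injective.injOn, h (i :: w) := by
  have hF' : F = (Finset.range (N.m l).length).biUnion fun i =>
      (F.preimage (List.cons i) List.cons_injective.injOn).map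
        ⟨List.cons i, List.cons_injective⟩ := by
    ext w
    simp only [Finset.mem_biUnion, Finset.mem_range, Finset.mem_map, Finset.mem_preimage,
      Function.Embedding.coeFn_mk]
    constructor
    · intro hw
      obtain _ | ⟨i, w⟩ := w
      · obtain ⟨d, hd, hl, -⟩ := (hF _).mp hw
        cases hd
        cases hl
      · refine ⟨i, ?_, w, hw, rfl⟩
        by_contra hi
        obtain ⟨d, hd, -⟩ := (hF _).mp hw
        rw [run_cons_of_le (not_lt.mp hi)] at hd
        cases hd
    · rintro ⟨i, -, w, hw, rfl⟩
      exact hw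
  conv_lhs => rw [hF']
  rw [Finset.sum_biUnion]
  · simp
  · intro i _ j _ hij
    rw [Function.onFun, Finset.disjoint_left]
    simp only [Finset.mem_map, Function.Embedding.coeFn_mk, not_exists, not_and]
    rintro _ ⟨a, _, rfl⟩ b _ h
    exact hij (List.cons.inj h).1.symm

end NTM

/-! ### Comparing paths -/

/-- One step of the comparison of a path with a given path of which `s` is the next choice, if there
is one; `i` is the next choice on the path and `o` the outcome for the choices before. -/
def compareStep (o : Ordering) (s : Option ℕ) (i : ℕ) : Ordering :=
  o.then (s.elim .gt fun j => compare i j)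

/-- Compares the path `w` with `p`, reading both from the start, until `w` ends. -/
def comparePath : Ordering → List ℕ → List ℕ → Ordering
  | o, _, [] => o
  | o, p, i :: w => comparePath (compareStep o p.head? i) p.tail w

theorem comparePath_of_ne {o : Ordering} (ho : o ≠ .eq) (p w : List ℕ) :
    comparePath o p w = o := by
  induction w generalizing p with
  | nil => rfl
  | cons i w ih =>
    have : compareStep o p.head? i = o := by cases o <;> simp_all [compareStep]
    rw [comparePath, this, ih]

theorem comparePath_eq_gt_iff (p w : List ℕ) : comparePath .eq p w = .gt ↔ p < w := by
  induction w generalizing p with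
  | nil => simp [comparePath]
  | cons i w ih =>
    obtain _ | ⟨j, p⟩ := p
    · simp [comparePath, compareStep, comparePath_of_ne]
    · rw [List.cons_lt_cons_iff, comparePath]
      rcases lt_trichotomy i j with h | h | h
      · have : compareStep .eq (some j) i = .lt := by simp [compareStep, compare_lt_iff_lt, h]
        simp only [List.head?_cons, this, comparePath_of_ne (o := .lt) (by simp)]
        simp
        omega
      · subst h
        have : compareStep .eq (some i) i = .eq := by simp [compareStep]
        simp [this, ih]
      · have : compareStep .eq (some j) i = .gt := by simp [compareStep, compare_gt_iff_gt, h]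
        simp [this, comparePath_of_ne, h]

/-! ### The stacks and the finite control of the counting machine -/

/-- The parameters of the counting machine. -/
structure Setup where
  /-- the machine whose accepting paths are guessed -/
  N : NTM
  /-- the machine that prints numbers -/
  M : FinTM2
  [finiteM : ∀ k, Finite (M.Γ k)]
  /-- the input symbol of the printer -/
  zero : M.Γ M.k₀
  /-- the output symbols of the printer -/
  decode : M.Γ M.k₁ → Option Bool
  /-- the width of the window in which numbers of digits are searched -/
  κ : ℕ
  /-- a bound for the nondeterministic choices of `N` -/
  B : ℕ

attribute [instance] Setup.finiteM FinTM2.kFin FinTM2.ΛFin FinTM2.σFin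

/-- The stacks of bits and delimiters of the counting machine. -/
inductive Own
  | inp | aux | pl | pb | cur | acc | c | d | out | res
  deriving DecidableEq

instance : Finite Own := by
  refine Finite.of_injective (β := Fin 10) (fun o => match o with
    | .inp => 0 | .aux => 1 | .pl => 2 | .pb => 3 | .cur => 4 | .acc => 5 | .c => 6 | .d => 7
    | .out => 8 | .res => 9) ?_
  intro a b h
  cases a <;> cases b <;> first | rfl | simp at h

/-- The stacks of the counting machine: its own ones, two stacks for paths, and those of the two
machines that it runs. -/
inductive StkIdx (G : Setup)
  | own (o : Own)
  | prev
  | new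
  | sim (k : G.N.K)
  | print (k : G.M.K)
  deriving DecidableEq

variable {G : Setup}

instance : Finite (StkIdx G) := by
  refine Finite.of_injective (β := Own ⊕ Bool ⊕ G.N.K ⊕ G.M.K) (fun o => match o with
    | .own o => .inl o | .prev => .inr (.inl false) | .new => .inr (.inl true)
    | .sim k => .inr (.inr (.inl k)) | .print k => .inr (.inr (.inr k))) ?_
  intro a b h
  cases a <;> cases b <;> simp_all

/-- The stack alphabets of the counting machine. -/
@[reducible] def StkIdx.Γ : StkIdx G → Type
  | own _ => Option Bool
  | prev => Fin (G.B + 1)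
  | new => Fin (G.B + 1)
  | sim k => G.N.Γ k
  | print k => G.M.Γ k

instance (k : StkIdx G) : Finite k.Γ := by
  cases k <;> dsimp only [StkIdx.Γ] <;> infer_instance

/-- The finite control of the counting machine. -/
@[ext] structure Ctl (G : Setup) where
  /-- the symbol last read -/
  r : Option (Option Bool)
  /-- a symbol read in addition to `r` -/
  r' : Option (Option Bool)
  /-- a symbol read in addition to `r` and `r'` -/
  r'' : Option (Option Bool)
  /-- a carry or borrow -/
  b : Bool
  /-- a second carry -/
  b' : Bool
  /-- the delimiter of the current word has been read -/
  fin : Bool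
  /-- the number of digits in excess of another number, if it is at most `κ` -/
  ex : Fin (G.κ + 2)
  /-- a choice on a path -/
  p : Option (Fin (G.B + 1))
  /-- the outcome of the comparison of two paths -/
  cmp : Ordering
  /-- the state of the simulated machine -/
  nv : G.N.σ
  /-- the state of the printer -/
  mv : G.M.σ
  /-- to stop is to accept -/
  accept : Bool

instance : Finite Ordering :=
  Finite.of_injective (β := Fin 3) (fun o => match o with | .lt => 0 | .eq => 1 | .gt => 2) (by
    intro a b h; cases a <;> cases b <;> first | rfl | simp at h)

instance : Finite (Ctl G) := by
  refine Finite.of_injective (β := Option (Option Bool) × Option (Option Bool) ×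
    Option (Option Bool) × Bool × Bool × Bool × Fin (G.κ + 2) × Option (Fin (G.B + 1)) ×
    Ordering × G.N.σ × G.M.σ × Bool) (fun v => (v.r, v.r', v.r'', v.b, v.b', v.fin, v.ex, v.p,
      v.cmp, v.nv, v.mv, v.accept)) ?_
  intro v w h
  simp only [Prod.mk.injEq] at h
  ext1 <;> tauto

/-- The initial state of the finite control. -/
def ctl₀ : Ctl G :=
  ⟨none, none, none, false, false, false, 0, none, .eq, G.N.initialState, G.M.initialState, false⟩

/-- The contents of the stacks. -/
structure Env (G : Setup) where
  /-- the input -/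
  inp : List (Option Bool) := []
  /-- auxiliary stack, empty between the phases -/
  aux : List (Option Bool) := []
  /-- the printed numbers -/
  pl : List (Option Bool) := []
  /-- the part of `pl` that has been read -/
  pb : List (Option Bool) := []
  /-- the number that is being read -/
  cur : List (Option Bool) := []
  /-- an accumulator -/
  acc : List (Option Bool) := []
  /-- the current coefficient -/
  c : List (Option Bool) := []
  /-- the current table of differences -/
  d : List (Option Bool) := []
  /-- the next table of differences, reversed -/
  out : List (Option Bool) := []
  /-- a result, reversed -/
  res : List (Option Bool) := []
  /-- the accepting path guessed last -/
  prev : List (Fin (G.B + 1)) := []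
  /-- the path that is being guessed, reversed -/
  new : List (Fin (G.B + 1)) := []
  /-- the stacks of the simulated machine -/
  sim : ∀ k, List (G.N.Γ k) := fun _ => []
  /-- the stacks of the printer -/
  print : ∀ k, List (G.M.Γ k) := fun _ => []

namespace Env

/-- The stacks as a family. -/
def stk (e : Env G) : ∀ k : StkIdx G, List k.Γ
  | .own .inp => e.inp
  | .own .aux => e.aux
  | .own .pl => e.pl
  | .own .pb => e.pb
  | .own .cur => e.cur
  | .own .acc => e.acc
  | .own .c => e.c
  | .own .d => e.d
  | .own .out => e.out
  | .own .res => e.res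
  | .prev => e.prev
  | .new => e.new
  | .sim k => e.sim k
  | .print k => e.print k

/-- The stack `o`. -/
def get (e : Env G) (o : Own) : List (Option Bool) := e.stk (.own o)

/-- Replace the contents of the stack `o`. -/
def set (e : Env G) (o : Own) (l : List (Option Bool)) : Env G :=
  match o with
  | .inp => { e with inp := l }
  | .aux => { e with aux := l }
  | .pl => { e with pl := l }
  | .pb => { e with pb := l }
  | .cur => { e with cur := l }
  | .acc => { e with acc := l }
  | .c => { e with c := l }
  | .d => { e with d := l }
  | .out => { e with out := l }
  | .res => { e with res := l }

variable (e : Env G)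

@[simp] theorem update_own (o : Own) (l : List (Option Bool)) :
    Function.update e.stk (.own o) l = (e.set o l).stk := by
  funext k
  by_cases h : k = .own o
  · subst h
    cases o <;> simp [set, stk]
  · rw [Function.update_of_ne h]
    rcases k with k | _ | _ | k | k
    · cases o <;> cases k <;> first | rfl | exact absurd rfl h
    all_goals cases o <;> rfl

@[simp] theorem update_prev (l : List (Fin (G.B + 1))) :
    Function.update e.stk .prev l = { e with prev := l }.stk := by
  funext k
  by_cases h : k = .prev
  · subst h; simp [stk]
  · rw [Function.update_of_ne h]
    rcases k with k | _ | _ | k | k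
    · cases k <;> rfl
    all_goals first | rfl | exact absurd rfl h

@[simp] theorem update_new (l : List (Fin (G.B + 1))) :
    Function.update e.stk .new l = { e with new := l }.stk := by
  funext k
  by_cases h : k = .new
  · subst h; simp [stk]
  · rw [Function.update_of_ne h]
    rcases k with k | _ | _ | k | k
    · cases k <;> rfl
    all_goals first | rfl | exact absurd rfl h

@[simp] theorem update_sim (k : G.N.K) (l : List (G.N.Γ k)) :
    Function.update e.stk (.sim k) l = { e with sim := Function.update e.sim k l }.stk := by
  funext j
  by_cases h : j = .sim k
  · subst h; simp [stk]
  · rw [Function.update_of_ne h]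
    rcases j with j | _ | _ | j | j
    · cases j <;> rfl
    · rfl
    · rfl
    · have : j ≠ k := fun h' => h (by rw [h'])
      simp [stk, Function.update_of_ne this]
    · rfl

@[simp] theorem update_print (k : G.M.K) (l : List (G.M.Γ k)) :
    Function.update e.stk (.print k) l = { e with print := Function.update e.print k l }.stk := by
  funext j
  by_cases h : j = .print k
  · subst h; simp [stk]
  · rw [Function.update_of_ne h]
    rcases j with j | _ | _ | j | j
    · cases j <;> rfl
    · rfl
    · rfl
    · rfl
    · have : j ≠ k := fun h' => h (by rw [h'])
      simp [stk, Function.update_of_ne this]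

@[simp] theorem stk_sim (k) : e.stk (.sim k) = e.sim k := rfl
@[simp] theorem stk_print (k) : e.stk (.print k) = e.print k := rfl
@[simp] theorem stk_own (o) : e.stk (.own o) = e.get o := rfl

@[simp] theorem get_set_self (o l) : (e.set o l).get o = l := by cases o <;> rfl

theorem get_set_of_ne {o o' : Own} (h : o ≠ o') (l) : (e.set o' l).get o = e.get o := by
  cases o <;> cases o' <;> first | rfl | exact absurd rfl h

@[simp] theorem set_set (o l l') : (e.set o l).set o l' = e.set o l' := by cases o <;> rfl

theorem set_comm {o o' : Own} (h : o ≠ o') (l l') :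
    (e.set o l).set o' l' = (e.set o' l').set o l := by
  cases o <;> cases o' <;> first | rfl | exact absurd rfl h

@[simp] theorem set_get (o : Own) : e.set o (e.get o) = e := by cases o <;> rfl

end Env

/-! ### Moving and clearing stacks -/

/-- A statement of the counting machine. -/
abbrev St (G : Setup) := Stmt (K := StkIdx G) StkIdx.Γ Bool (Ctl G)

/-- A program of the counting machine. -/
abbrev Pr (G : Setup) := Prog (K := StkIdx G) StkIdx.Γ (Ctl G)

/-- A deterministic run that starts and ends in the initial state of the finite control. -/
def Exec (P : Pr G) (e e' : Env G) (T : ℕ) : Prop := P.Runs ctl₀ e.stk ctl₀ e'.stk T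

theorem Exec.mono {P : Pr G} {e e' : Env G} {T T' : ℕ} (h : Exec P e e' T) (hT : T ≤ T') :
    Exec P e e' T' := Prog.Runs.mono h hT

theorem Exec.seq {P Q : Pr G} {e e' e'' : Env G} {T T' : ℕ} (h : Exec P e e' T)
    (h' : Exec Q e' e'' T') : Exec (P.seq Q) e e'' (T + T') := Prog.Runs.seq h h'

/-- Move the symbols of the stack `a` to the stack `b`, which reverses their order. -/
def move (a b : Own) : Pr G :=
  .block [.pop (.own a) (fun v s => { v with r := s }) <|
    .branch (fun v => v.r.isSome)
      (.push (.own b) (fun v => v.r.getD none) <| .load (fun v => { v with r := none }) <|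
        .goto fun _ => true)
      (.goto fun _ => false)]

theorem runs_move {a b : Own} (hab : a ≠ b) (e : Env G) :
    Exec (move a b) e ((e.set a []).set b ((e.get a).reverse ++ e.get b))
      ((e.get a).length + 1) := by
  generalize hl : e.get a = l
  induction l generalizing e with
  | nil =>
    refine Prog.Runs.block_exit ?_
    have h : (e.set a []).set b (e.get b) = e := by
      rw [← e.get_set_of_ne hab.symm [], Env.set_get, ← hl, Env.set_get]
    simp [hl, h, ctl₀]
    rw [← hl, e.set_get]
  | cons s l ih =>
    refine Prog.Runs.block_step (v' := ctl₀) (S' := ((e.set a l).set b (s :: e.get b)).stk) ?_ ?_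
    · simp [hl, Env.get_set_of_ne _ hab.symm, ctl₀]
    · have := ih ((e.set a l).set b (s :: e.get b)) (by simp [Env.get_set_of_ne _ hab])
      change Exec (move a b) _ _ _
      simpa [Env.set_comm _ hab.symm] using this

/-- Clear the stack `a`. -/
def clear (a : Own) : Pr G :=
  .block [.pop (.own a) (fun v s => { v with r := s }) <|
    .branch (fun v => v.r.isSome)
      (.load (fun v => { v with r := none }) <| .goto fun _ => true)
      (.goto fun _ => false)]

theorem runs_clear (a : Own) (e : Env G) :
    Exec (clear a) e (e.set a []) ((e.get a).length + 1) := by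
  generalize hl : e.get a = l
  induction l generalizing e with
  | nil =>
    refine Prog.Runs.block_exit ?_
    simp [hl, ctl₀]
  | cons s l ih =>
    refine Prog.Runs.block_step (v' := ctl₀) (S' := (e.set a l).stk) ?_ ?_
    · simp [hl, ctl₀]
    · change Exec (clear a) _ _ _
      simpa using ih (e.set a l) (by simp)

/-! ### Arithmetic on binary numbers -/

/-- A number on a stack: its binary digits, the least significant one on top. -/
def num (n : ℕ) : List (Option Bool) := n.bits.map some

/-- A list of numbers on a stack, each followed by a delimiter. -/
def nums (l : List ℕ) : List (Option Bool) := l.flatMap fun n => num n ++ [none]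

@[simp] theorem num_zero : num 0 = [] := by simp [num]

theorem bodd_toNat_add (n : ℕ) : n.bodd.toNat + 2 * (n / 2) = n := by
  have := Nat.mod_two_of_bodd n
  omega

theorem num_of_ne_zero {n : ℕ} (h : n ≠ 0) : num n = some n.bodd :: num (n / 2) := by
  have h1 : n = Nat.bit n.bodd (n / 2) := by
    rw [← Nat.div2_val, Nat.bit_bodd_div2]
  conv_lhs => rw [num, h1]
  rw [Nat.bits_append_bit, num, List.map_cons]
  intro h0
  have := bodd_toNat_add n
  cases hb : n.bodd
  · simp [hb, h0] at this; omega
  · rfl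

theorem length_num (n : ℕ) : (num n).length = n.size := by
  rw [num, List.length_map, Nat.size_eq_bits_len]

/-- The least significant digit of `n`, if there is one. -/
def digit? (n : ℕ) : Option (Option Bool) := if n = 0 then none else some (some n.bodd)

@[simp] theorem digit?_zero : digit? 0 = none := rfl

theorem isNone_digit? (n : ℕ) : (digit? n).isNone = decide (n = 0) := by
  by_cases h : n = 0 <;> simp [digit?, h]

theorem head?_num (n : ℕ) : (num n).head? = digit? n := by
  by_cases h : n = 0 <;> simp [digit?, h, num_of_ne_zero]

theorem tail_num (n : ℕ) : (num n).tail = num (n / 2) := by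
  by_cases h : n = 0 <;> simp [h, num_of_ne_zero]

theorem size_div_two {n : ℕ} (h : n ≠ 0) : n.size = (n / 2).size + 1 := by
  rw [← length_num, num_of_ne_zero h, List.length_cons, length_num]

@[simp] theorem nums_nil : nums [] = [] := rfl

@[simp] theorem nums_cons (n : ℕ) (l : List ℕ) : nums (n :: l) = num n ++ none :: nums l := by
  simp [nums]

namespace Ctl

/-- The value of a symbol that was read, missing digits being `0`. -/
def bit (s : Option (Option Bool)) : ℕ := (s.elim false (·.getD false)).toNat

@[simp] theorem bit_none : bit none = 0 := rfl

@[simp] theorem bit_digit? (n : ℕ) : bit (digit? n) = n.bodd.toNat := by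
  by_cases h : n = 0 <;> simp [digit?, bit, h]

@[simp] theorem bit_some_some (b : Bool) : bit (some (some b)) = b.toNat := rfl

/-- The sum of the three digits and the two carries. -/
def total (v : Ctl G) : ℕ := bit v.r + bit v.r' + bit v.r'' + v.b.toNat + v.b'.toNat

/-- Forget the symbols read. -/
def reset (v : Ctl G) : Ctl G := { v with r := none, r' := none, r'' := none }

end Ctl

/-- One digit of the ternary addition. The digits of `c` are saved on `aux`. Adding three digits to
the carry gives at most `5`, so that the carry is at most `2`; it is stored as the sum of the bits
`b` and `b'`. -/
def addStmt : St G :=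
  let finish : St G :=
    .branch (fun v => v.r.isNone && v.r'.isNone && v.fin && !v.b && !v.b')
      (.push (.own .out) (fun _ => none) <| .load (fun v => { v with fin := false }) <|
        .goto fun _ => false)
      (.push (.own .res) (fun v => some (decide (v.total % 2 = 1))) <|
        .push (.own .out) (fun v => some (decide (v.total % 2 = 1))) <|
        .load (fun v => { v with b := decide (2 ≤ v.total), b' := decide (4 ≤ v.total) }) <|
        .load Ctl.reset <| .goto fun _ => true)
  let save : St G :=
    .branch (fun v => v.r'.isSome) (.push (.own .aux) (fun v => v.r'.getD none) finish) finish
  .pop (.own .acc) (fun v s => { v with r := s }) <|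
    .pop (.own .c) (fun v s => { v with r' := s }) <|
    .branch (fun v => v.fin) save <|
    .pop (.own .d) (fun v s => match s with
      | some (some _) => { v with r'' := s }
      | _ => { v with fin := true }) save

/-- Adds `c` and the first number on `d` to `acc`. The sum is written on `res` and `out`, the least
significant digit first. -/
def add : Pr G := .block [addStmt]

theorem stepAux_addStmt {a c d : ℕ} {rest : List (Option Bool)} {f b b' : Bool}
    (hf : f = true → d = 0) (h0 : a + c + d + b.toNat + b'.toNat ≠ 0) {e : Env G}
    (hacc : e.acc = num a) (hc : e.c = num c)
    (hd : e.d = if f then rest else num d ++ none :: rest) {t : ℕ}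
    (ht : a.bodd.toNat + c.bodd.toNat + d.bodd.toNat + b.toNat + b'.toNat = t) :
    stepAux addStmt { ctl₀ with fin := f, b := b, b' := b' } e.stk =
      ⟨some true, { ctl₀ with fin := f || decide (d = 0), b := decide (2 ≤ t),
                              b' := decide (4 ≤ t) },
        { e with acc := num (a / 2), c := num (c / 2),
                 d := if f || decide (d = 0) then rest else num (d / 2) ++ none :: rest,
                 aux := if c = 0 then e.aux else some c.bodd :: e.aux,
                 res := some (decide (t % 2 = 1)) :: e.res,
                 out := some (decide (t % 2 = 1)) :: e.out }.stk⟩ := by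
  have hfin : ((digit? a).isNone && (digit? c).isNone && (f || decide (d = 0)) && !b && !b') =
      false := by
    by_contra h
    simp only [Bool.not_eq_false, Bool.and_eq_true, isNone_digit?, decide_eq_true_eq,
      Bool.or_eq_true, Bool.not_eq_true'] at h
    obtain ⟨⟨⟨⟨rfl, rfl⟩, hd0⟩, rfl⟩, rfl⟩ := h
    have : d = 0 := hd0.elim hf id
    simp [this] at h0
  have hsave : (digit? c).isSome = !decide (c = 0) := by
    rw [← Option.not_isNone, isNone_digit?]
  have hhead : f = false → e.d.head? = some (if d = 0 then none else some d.bodd) := by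
    rintro rfl
    by_cases h : d = 0 <;> simp [hd, h, num_of_ne_zero]
  have htail : f = false → e.d.tail = if d = 0 then rest else num (d / 2) ++ none :: rest := by
    rintro rfl
    by_cases h : d = 0 <;> simp [hd, h, num_of_ne_zero]
  have hget : c ≠ 0 → (digit? c).getD none = some c.bodd := fun h => by simp [digit?, h]
  cases f
  · by_cases hd0 : d = 0
    · by_cases hc0 : c = 0 <;>
      · simp [hd0, hc0] at ht
        simp [addStmt, Env.stk, Env.set, hacc, hc, htail, hhead, head?_num, tail_num,
          hsave, Ctl.total, Ctl.reset, ctl₀, hd0, hc0]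
        rw [cond_eq_ite, if_neg (by simpa [hc0, hd0] using hfin)]
        simp [ht, hget, hc0]
    · by_cases hc0 : c = 0 <;>
      · try simp [hc0] at ht
        simp [addStmt, Env.stk, Env.set, hacc, hc, htail, hhead, head?_num, tail_num,
          hsave, Ctl.total, Ctl.reset, ctl₀, hd0, hc0, hget, ht]
  · obtain rfl := hf rfl
    by_cases hc0 : c = 0 <;>
      · simp [hc0] at ht
        simp [addStmt, Env.stk, Env.set, hacc, hc, hd, head?_num, tail_num,
          hsave, Ctl.total, Ctl.reset, ctl₀, hc0]
        rw [cond_eq_ite, if_neg (by simpa [hc0] using hfin)]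
        simp [ht, hget, hc0]

theorem runs_add_aux (a c d : ℕ) (rest : List (Option Bool)) (f b b' : Bool) (hf : f = true → d = 0)
    (n : ℕ) (hn : a + c + d + b.toNat + b'.toNat = n) (e : Env G) (hacc : e.acc = num a)
    (hc : e.c = num c) (hd : e.d = if f then rest else num d ++ none :: rest) :
    add.Runs { ctl₀ with fin := f, b := b, b' := b' } e.stk ctl₀
      { e with acc := [], c := [], d := rest, aux := (num c).reverse ++ e.aux,
               res := (num n).reverse ++ e.res,
               out := none :: ((num n).reverse ++ e.out) }.stk (n.size + 1) := by
  induction n using Nat.strong_induction_on generalizing a c d f b b' e with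
  | _ n ih =>
  by_cases h0 : n = 0
  · subst h0
    obtain ⟨rfl, rfl, rfl, rfl, rfl⟩ : a = 0 ∧ c = 0 ∧ d = 0 ∧ b = false ∧ b' = false := by
      refine ⟨by omega, by omega, by omega, ?_, ?_⟩ <;> cases b <;> cases b' <;> simp at hn ⊢
    refine Prog.Runs.block_exit ?_
    cases f <;> simp_all [addStmt, ctl₀, Env.stk, Env.set]
  · have key := fun x => bodd_toNat_add x
    set t := a.bodd.toNat + c.bodd.toNat + d.bodd.toNat + b.toNat + b'.toNat with ht
    have htn : t + 2 * (a / 2 + c / 2 + d / 2) = n := by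
      have := key a; have := key c; have := key d; omega
    have ht5 : t ≤ 5 := by
      have h := fun b : Bool => Bool.toNat_le b
      have := h a.bodd; have := h c.bodd; have := h d.bodd; have := h b; have := h b'; omega
    have hcarry : (decide (2 ≤ t)).toNat + (decide (4 ≤ t)).toNat = t / 2 := by
      clear_value t
      interval_cases t <;> rfl
    have hdig : decide (t % 2 = 1) = n.bodd := by
      have h1 : t % 2 = n % 2 := by omega
      rw [h1, Nat.mod_two_of_bodd]
      cases n.bodd <;> rfl
    have hrc : (num c).reverse ++ e.aux =
        (num (c / 2)).reverse ++ if c = 0 then e.aux else some c.bodd :: e.aux := by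
      by_cases h : c = 0
      · simp [h]
      · rw [num_of_ne_zero h]; simp [h]
    have hrn : ∀ l, (num n).reverse ++ l = (num (n / 2)).reverse ++ some n.bodd :: l := by
      intro l
      rw [num_of_ne_zero h0]; simp
    rw [size_div_two h0, hrc, hrn, hrn]
    refine Prog.Runs.block_step (stepAux_addStmt hf (by omega) hacc hc hd ht.symm) ?_
    rw [hdig]
    exact ih (n / 2) (by omega) (a / 2) (c / 2) (d / 2) (f || decide (d = 0))
      (decide (2 ≤ t)) (decide (4 ≤ t)) (by
        intro h
        rcases Bool.or_eq_true_iff.mp h with h | h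
        · simp [hf h]
        · simp [of_decide_eq_true h]) (by omega) _ rfl rfl rfl

theorem exec_add (a c d : ℕ) (rest : List (Option Bool)) (e : Env G) :
    Exec add { e with acc := num a, c := num c, d := num d ++ none :: rest }
      { e with acc := [], c := [], d := rest, aux := (num c).reverse ++ e.aux,
               res := (num (a + d + c)).reverse ++ e.res,
               out := none :: ((num (a + d + c)).reverse ++ e.out) }
      ((a + d + c).size + 1) :=
  runs_add_aux a c d rest false false false (by simp) _ (by simp; omega) _ rfl rfl rfl

/-- Loop as long as the stack `a` is not empty. -/
def whileNonempty (a : Own) (P : Pr G) : Pr G :=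
  .loop (.peek (.own a) (fun v s => { v with r := s }) <|
    .branch (fun v => v.r.isSome) (.load Ctl.reset <| .goto fun _ => true)
      (.goto fun _ => false)) P

theorem Exec.whileNonempty {a : Own} {P : Pr G} {e e' e'' : Env G} {T T' : ℕ} (ha : e.get a ≠ [])
    (h : Exec P e e' T) (h' : Exec (whileNonempty a P) e' e'' T') :
    Exec (CountingClasses.whileNonempty a P) e e'' (T' + T + 1) := by
  refine Prog.Runs.loop ?_ h h'
  obtain ⟨s, l, hs⟩ := List.exists_cons_of_ne_nil ha
  simp [hs, Ctl.reset, ctl₀]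

theorem exec_whileNonempty_nil {a : Own} {P : Pr G} {e : Env G} (ha : e.get a = []) :
    Exec (whileNonempty a P) e e 1 := by
  refine Prog.Runs.loop_exit ?_
  simp [ha, ctl₀]

/-- Replaces the numbers on `d` by the running sums, which are left on `out`, and leaves their total
on `acc`. -/
def sumTable : Pr G :=
  whileNonempty .d (add.seq ((move .res .acc).seq (move .aux .c)))

theorem exec_sumTable (c ℓ : ℕ) (l : List ℕ) (acc : ℕ) (e : Env G)
    (hℓ : (acc + l.sum + c * l.length).size ≤ ℓ) :
    Exec sumTable { e with acc := num acc, c := num c, d := nums l, aux := [], res := [] }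
      { e with acc := num (acc + l.sum + c * l.length), c := num c, d := [], aux := [], res := [],
               out := (nums (runningSums c acc l)).reverse ++ e.out }
      (l.length * (3 * ℓ + 4) + 1) := by
  induction l generalizing acc e with
  | nil =>
    simpa [runningSums, sumTable] using exec_whileNonempty_nil (G := G) (a := .d)
      (e := { e with acc := num acc, c := num c, d := [], aux := [], res := [] }) rfl
  | cons d l ih =>
    set s := acc + d + c with hs
    have htot : acc + (d :: l).sum + c * (d :: l).length = s + l.sum + c * l.length := by
      simp [hs, Nat.mul_add]; ring
    rw [htot] at hℓ ⊢
    have hsℓ : s.size ≤ ℓ := (Nat.size_le_size (by omega)).trans hℓ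
    have hcℓ : c.size ≤ ℓ := (Nat.size_le_size (by omega)).trans hsℓ
    set out := none :: ((num s).reverse ++ e.out) with hout
    have h1 := exec_add acc c d (nums l) { e with aux := [], res := [] }
    have h2 := runs_move (G := G) (a := .res) (b := .acc) (by decide) { e with
      acc := [], c := [], d := nums l, aux := (num c).reverse, res := (num s).reverse, out := out }
    have h3 := runs_move (G := G) (a := .aux) (b := .c) (by decide) { e with
      acc := num s, c := [], d := nums l, aux := (num c).reverse, res := [], out := out }
    have h4 := ih s { e with out := out } hℓ
    simp only [Env.get, Env.stk, Env.set, List.reverse_reverse, List.append_nil, List.length_reverse,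
      length_num] at h1 h2 h3
    have h5 := Exec.whileNonempty (a := .d)
      (e := { e with acc := num acc, c := num c, d := nums (d :: l), aux := [], res := [] })
      (by simp [Env.get, Env.stk]) (nums_cons d l ▸ h1.seq (h2.seq h3)) h4
    simp only [runningSums, ← hs, nums_cons, List.reverse_append, List.reverse_cons,
      List.append_assoc, List.cons_append, List.nil_append] at h5 ⊢
    refine h5.mono ?_
    simp only [List.length_cons, Nat.add_mul]
    omega

theorem mem_runningSums_le {c acc d : ℕ} {l : List ℕ} (h : d ∈ runningSums c acc l) :
    d ≤ acc + l.sum + c * l.length := by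
  induction l generalizing acc with
  | nil => simp [runningSums] at h
  | cons n l ih =>
    simp only [List.sum_cons, List.length_cons, Nat.mul_add]
    rcases List.mem_cons.mp h with rfl | h
    · omega
    · have := ih h
      omega

theorem length_nums_le {l : List ℕ} {ℓ : ℕ} (h : ∀ n ∈ l, n.size ≤ ℓ) :
    (nums l).length ≤ l.length * (ℓ + 1) := by
  induction l with
  | nil => simp
  | cons n l ih =>
    have h1 := ih fun m hm => h m (List.mem_cons_of_mem _ hm)
    have h2 := h n List.mem_cons_self
    simp only [nums_cons, List.length_append, length_num, List.length_cons, Nat.add_mul] at h1 ⊢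
    omega

/-! ### Selecting a printed number -/

/-- A printed list of numbers. -/
def printed (ns : List ℕ) : List (Option Bool) := printWords (ns.map binary)

@[simp] theorem printed_cons (n : ℕ) (ns : List ℕ) :
    printed (n :: ns) = (binary n).map some ++ none :: printed ns := by
  simp [printed, printWords]

theorem reverse_map_binary (n : ℕ) : ((binary n).map some).reverse = num n := by
  simp [binary, num]

theorem length_printed_le {l : List ℕ} {ℓ : ℕ} (h : ∀ n ∈ l, n.size ≤ ℓ) :
    (printed l).length ≤ l.length * (ℓ + 1) := by
  induction l with
  | nil => simp [printed, printWords]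
  | cons n l ih =>
    have h1 := ih fun m hm => h m (List.mem_cons_of_mem _ hm)
    have h2 := h n List.mem_cons_self
    simp only [printed_cons, List.length_append, List.length_map, length_binary, List.length_cons,
      Nat.add_mul] at h1 ⊢
    omega

theorem length_le_length_printed (l : List ℕ) : l.length ≤ (printed l).length := by
  induction l with
  | nil => simp
  | cons n l ih => simp; omega

/-- Counting up to `κ + 1`. -/
def Ctl.cap (n : ℕ) : Fin (G.κ + 2) := ⟨min n (G.κ + 1), by omega⟩

theorem Ctl.cap_succ (n : ℕ) : cap (G := G) ((cap (G := G) n : ℕ) + 1) = cap (n + 1) := by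
  simp only [cap, Fin.mk.injEq]
  omega

/-- Moves the next word of `pl` to `cur`, keeping a copy on `pb`, and counts by how much it is longer
than `acc`. The part of `acc` that is compared is moved to `aux`. -/
def readWord : Pr G :=
  .block [.pop (.own .pl) (fun v s => { v with r := s }) <|
    .push (.own .pb) (fun v => v.r.getD none) <|
    .branch (fun v => (v.r.getD none).isSome)
      (.push (.own .cur) (fun v => v.r.getD none) <| .pop (.own .acc) (fun v s => { v with r' := s })
        <| .branch (fun v => v.r'.isSome)
          (.push (.own .aux) (fun v => v.r'.getD none) <| .load Ctl.reset <| .goto fun _ => true)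
          (.load (fun v => { v.reset with ex := Ctl.cap (v.ex + 1) }) <| .goto fun _ => true))
      (.load Ctl.reset <| .goto fun _ => false)]

theorem runs_readWord (w : List Bool) (l rest : List (Option Bool)) (E : ℕ) (e : Env G) :
    readWord.Runs { ctl₀ with ex := Ctl.cap E }
      { e with pl := w.map some ++ none :: rest, acc := l }.stk
      { ctl₀ with ex := Ctl.cap (E + (w.length - l.length)) }
      { e with pl := rest, pb := none :: ((w.map some).reverse ++ e.pb),
               cur := (w.map some).reverse ++ e.cur, acc := l.drop w.length,
               aux := (l.take w.length).reverse ++ e.aux }.stk (w.length + 1) := by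
  induction w generalizing l E e with
  | nil =>
    refine Prog.Runs.block_exit ?_
    simp [Env.stk, Env.set, Ctl.reset, ctl₀]
  | cons b w ih =>
    cases l with
    | nil =>
      have := ih [] (E + 1) { e with cur := some b :: e.cur, pb := some b :: e.pb }
      rw [show E + 1 + (w.length - ([] : List (Option Bool)).length) =
        E + ((b :: w).length - ([] : List (Option Bool)).length) by simp; omega] at this
      refine Prog.Runs.block_step (v' := { ctl₀ with ex := Ctl.cap (E + 1) })
        (S' := { e with pl := w.map some ++ none :: rest, pb := some b :: e.pb,
                        cur := some b :: e.cur, acc := [] }.stk) ?_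
        (by simpa [readWord] using this)
      simp [Env.stk, Env.set, Ctl.reset, ctl₀, Ctl.cap_succ]
    | cons s l =>
      have := ih l E { e with cur := some b :: e.cur, pb := some b :: e.pb, aux := s :: e.aux }
      refine Prog.Runs.block_step (v' := { ctl₀ with ex := Ctl.cap E })
        (S' := { e with pl := w.map some ++ none :: rest, pb := some b :: e.pb,
                        cur := some b :: e.cur, acc := l, aux := s :: e.aux }.stk) ?_
        (by simpa [readWord] using this)
      simp [Env.stk, Env.set, Ctl.reset, ctl₀]

/-- Tests whether the word that was read is longer by at most `κ`, and at least one, digits. -/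
def retryStmt : St G :=
  .branch (fun v => decide (1 ≤ (v.ex : ℕ) ∧ (v.ex : ℕ) ≤ G.κ))
    (.load (fun v => { v with ex := 0 }) <| .goto fun _ => false)
    (.load (fun v => { v with ex := 0 }) <| .goto fun _ => true)

/-- Reads words until one is longer than `acc` by at most `κ`, and at least one, digits. -/
def retry : Pr G := .loop retryStmt ((move .aux .acc).seq ((clear .cur).seq readWord))

theorem runs_retry_exit {n b : ℕ} (h : b.size < n.size ∧ n.size ≤ b.size + G.κ) (e : Env G) :
    retry.Runs { ctl₀ with ex := Ctl.cap (n.size - b.size) }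
      { e with acc := (num b).drop n.size, aux := ((num b).take n.size).reverse }.stk ctl₀
      { e with acc := [], aux := (num b).reverse }.stk 1 := by
  refine Prog.Runs.loop_exit ?_
  simp only [retryStmt, stepAux]
  rw [decide_eq_true (by simp only [Ctl.cap]; omega), List.drop_of_length_le, List.take_of_length_le]
  · rfl
  all_goals rw [length_num]; omega

theorem runs_retry (b a ℓ : ℕ) (ns : List ℕ) (n : ℕ)
    (hns : ∀ m ∈ n :: ns, m.size ≤ ℓ)
    (ha : (n :: ns).find? (fun a => decide (b.size < a.size ∧ a.size ≤ b.size + G.κ)) = some a)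
    (e : Env G) :
    ∃ l₁ l₂, l₁.reverse ++ l₂ = printed ns ∧
      retry.Runs { ctl₀ with ex := Ctl.cap (n.size - b.size) }
        { e with pl := printed ns, cur := num n, acc := (num b).drop n.size,
                 aux := ((num b).take n.size).reverse }.stk ctl₀
        { e with pl := l₂, pb := l₁ ++ e.pb, cur := num a, acc := [],
                 aux := (num b).reverse }.stk (ns.length * (3 * ℓ + 4) + 1) := by
  induction ns generalizing n e with
  | nil =>
    obtain rfl : a = n := by simpa using List.mem_of_find?_eq_some ha
    have hgood : b.size < a.size ∧ a.size ≤ b.size + G.κ := by simpa using List.find?_some ha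
    exact ⟨[], _, rfl, (runs_retry_exit hgood { e with pl := printed [], cur := num a }).mono
      (Nat.le_add_left _ _)⟩
  | cons n' ns ih =>
    by_cases hgood : b.size < n.size ∧ n.size ≤ b.size + G.κ
    · obtain rfl : n = a := by simpa [hgood] using ha
      exact ⟨[], _, rfl, (runs_retry_exit hgood
        { e with pl := printed (n' :: ns), cur := num n }).mono (Nat.le_add_left _ _)⟩
    · rw [List.find?_cons_of_neg (by simpa using hgood)] at ha
      have hn := hns n List.mem_cons_self
      have hn' := hns n' (by simp)
      obtain ⟨l₁, l₂, hl, hr⟩ := ih n' (fun m hm => hns m (List.mem_cons_of_mem _ hm)) ha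
        { e with pb := none :: (num n' ++ e.pb) }
      refine ⟨l₁ ++ none :: num n', l₂, by simp [← hl, ← reverse_map_binary], ?_⟩
      have h1 := runs_move (G := G) (a := .aux) (b := .acc) (by decide) { e with
        pl := printed (n' :: ns), cur := num n, acc := (num b).drop n.size,
        aux := ((num b).take n.size).reverse }
      have h2 := runs_clear (G := G) .cur { e with
        pl := printed (n' :: ns), cur := num n, acc := num b, aux := [] }
      have h3 := runs_readWord (G := G) (binary n') (num b) (printed ns) 0
        { e with cur := [], aux := [] }
      simp only [Env.get, Env.stk, Env.set, List.reverse_reverse, List.take_append_drop,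
        List.append_nil, List.length_reverse, length_num, reverse_map_binary, length_binary,
        Nat.zero_add, List.length_take] at h1 h2 h3
      rw [← printed_cons] at h3
      have hbody := Prog.Runs.seq h1 (Prog.Runs.seq h2 h3)
      have := Prog.Runs.loop (q := retryStmt)
        (v := { ctl₀ with ex := Ctl.cap (n.size - b.size) }) (S := { e with
          pl := printed (n' :: ns), cur := num n, acc := (num b).drop n.size,
          aux := ((num b).take n.size).reverse }.stk) ?_ hbody hr
      · rw [List.append_assoc, List.cons_append]
        exact Prog.Runs.mono this (by simp only [List.length_cons, Nat.add_mul]; omega)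
      · simp only [retryStmt, stepAux]
        rw [decide_eq_false (by simp only [Ctl.cap]; omega)]
        rfl

/-- Selects a printed number for the number on `acc`. -/
def select : Pr G := readWord.seq (retry.seq (move .aux .acc))

theorem exec_select (b a ℓ : ℕ) (hb : b.size ≤ ℓ) (ns : List ℕ) (hns : ∀ m ∈ ns, m.size ≤ ℓ)
    (ha : ns.find? (fun a => decide (b.size < a.size ∧ a.size ≤ b.size + G.κ)) = some a)
    (e : Env G) :
    ∃ l₁ l₂, l₁.reverse ++ l₂ = printed ns ∧
      Exec select
        { e with pl := printed ns, cur := [], acc := num b, aux := [], pb := [] }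
        { e with pl := l₂, pb := l₁, cur := num a, acc := num b, aux := [] }
        (ns.length * (3 * ℓ + 4) + 2 * ℓ + 3) := by
  obtain _ | ⟨n, ns⟩ := ns
  · simp at ha
  have hn := hns n List.mem_cons_self
  obtain ⟨l₁, l₂, hl, hr⟩ := runs_retry b a ℓ ns n hns ha { e with pb := none :: num n }
  refine ⟨l₁ ++ none :: num n, l₂, by simp [← hl, ← reverse_map_binary], ?_⟩
  have h1 := runs_readWord (G := G) (binary n) (num b) (printed ns) 0
    { e with cur := [], aux := [], pb := [] }
  have h2 := runs_move (G := G) (a := .aux) (b := .acc) (by decide) { e with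
    pl := l₂, pb := l₁ ++ none :: num n, cur := num a, acc := [], aux := (num b).reverse }
  simp only [Env.get, Env.stk, Env.set, List.reverse_reverse,
    List.append_nil, List.length_reverse, length_num, reverse_map_binary, length_binary,
    Nat.zero_add] at h1 h2
  rw [← printed_cons] at h1
  exact (Prog.Runs.seq h1 (Prog.Runs.seq hr h2)).mono
    (by simp only [List.length_cons, Nat.add_mul]; omega)

/-! ### Subtraction -/

/-- Subtracts the number on `acc` from the one on `cur`. The digits of the difference are written on
`res`, the least significant one first. -/
def sub : Pr G :=
  .block [.pop (.own .cur) (fun v s => { v with r := s }) <|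
    .branch (fun v => v.r.isSome)
      (.pop (.own .acc) (fun v s => { v with r' := s }) <|
        .push (.own .res)
          (fun v => some (decide ((Ctl.bit v.r + Ctl.bit v.r' + v.b.toNat) % 2 = 1))) <|
        .load (fun v => { v with b := decide (Ctl.bit v.r < Ctl.bit v.r' + v.b.toNat) }) <|
        .load Ctl.reset <| .goto fun _ => true)
      (.goto fun _ => false)]

theorem runs_sub (a b : ℕ) (w : Bool) (h : b + w.toNat ≤ a) (e : Env G) :
    ∃ j, (a - b - w.toNat).size + j = a.size ∧
      sub.Runs { ctl₀ with b := w } { e with cur := num a, acc := num b }.stk ctl₀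
        { e with cur := [], acc := [],
                 res := (num (a - b - w.toNat) ++ List.replicate j (some false)).reverse
                   ++ e.res }.stk (a.size + 1) := by
  induction a using Nat.strong_induction_on generalizing b w e with
  | _ a ih =>
  by_cases ha : a = 0
  · subst ha
    obtain ⟨rfl, hw⟩ : b = 0 ∧ w.toNat = 0 := by omega
    obtain rfl : w = false := by cases w <;> simp_all
    refine ⟨0, by simp, Prog.Runs.block_exit ?_⟩
    simp [Env.stk, Env.set, ctl₀]
  · have hA := bodd_toNat_add a
    have hB := bodd_toNat_add b
    set w' := decide (a.bodd.toNat < b.bodd.toNat + w.toNat) with hw'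
    set d := a - b - w.toNat with hd
    have hbit := fun b : Bool => Bool.toNat_le b
    have h1 := hbit a.bodd
    have h2 := hbit b.bodd
    have h3 := hbit w
    have hD := bodd_toNat_add d
    have h4 := hbit d.bodd
    have key : b / 2 + w'.toNat ≤ a / 2 ∧ a / 2 - b / 2 - w'.toNat = d / 2 := by
      by_cases hlt : a.bodd.toNat < b.bodd.toNat + w.toNat
      · simp only [hw', hlt, decide_true, Bool.toNat_true]; omega
      · simp only [hw', hlt, decide_false, Bool.toNat_false]; omega
    have hdig : decide ((a.bodd.toNat + b.bodd.toNat + w.toNat) % 2 = 1) = d.bodd := by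
      have h1 : (a.bodd.toNat + b.bodd.toNat + w.toNat) % 2 = d % 2 := by omega
      rw [h1, Nat.mod_two_of_bodd]
      cases d.bodd <;> rfl
    obtain ⟨j, hj, hr⟩ := ih (a / 2) (by omega) (b / 2) w' key.1 { e with res := some d.bodd :: e.res }
    rw [key.2] at hj hr
    refine ⟨if d = 0 then j + 1 else j, ?_, ?_⟩
    · rw [size_div_two ha]
      split_ifs with h0
      · simp [h0] at hj ⊢; omega
      · rw [size_div_two h0]; omega
    · rw [size_div_two ha]
      have hl : (num d ++ List.replicate (if d = 0 then j + 1 else j) (some false)).reverse ++ e.res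
          = (num (d / 2) ++ List.replicate j (some false)).reverse ++ some d.bodd :: e.res := by
        by_cases h0 : d = 0
        · simp [h0, List.replicate_succ]
        · simp [h0, num_of_ne_zero]
      rw [hl]
      refine Prog.Runs.block_step ?_ hr
      have hs : (digit? a).isSome = true := by simp [digit?, ha]
      simp [Env.stk, Env.set, ctl₀, head?_num, tail_num, Ctl.reset, hdig, ← hw', hs]

/-- Removes leading zeros from `res`, and moves the first digit that is not zero to `c`. -/
def stripZeros : Pr G :=
  .block [.pop (.own .res) (fun v s => { v with r := s }) <|
    .branch (fun v => decide (v.r = some (some false))) (.load Ctl.reset <| .goto fun _ => true) <|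
    .branch (fun v => v.r.isSome)
      (.push (.own .c) (fun v => v.r.getD none) <| .load Ctl.reset <| .goto fun _ => false)
      (.goto fun _ => false)]

/-- Moves the number on `res` to `c`, without leading zeros. -/
def strip : Pr G := stripZeros.seq (move .res .c)

theorem exists_num_eq {n : ℕ} (h : n ≠ 0) : ∃ l, num n = l ++ [some true] := by
  induction n using Nat.strong_induction_on with
  | _ n ih =>
  rw [num_of_ne_zero h]
  by_cases h2 : n / 2 = 0
  · have : n.bodd = true := by
      have := bodd_toNat_add n
      cases hb : n.bodd
      · simp [hb, h2] at this; omega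
      · rfl
    exact ⟨[], by simp [h2, this]⟩
  · obtain ⟨l, hl⟩ := ih (n / 2) (by omega) h2
    exact ⟨some n.bodd :: l, by simp [hl]⟩

theorem exec_strip (n j : ℕ) (e : Env G) :
    Exec strip { e with res := (num n ++ List.replicate j (some false)).reverse, c := [] }
      { e with res := [], c := num n } (n.size + j + 2) := by
  have h1 : ∃ l₁ l₂, l₂.reverse ++ l₁ = num n ∧ l₂.length ≤ n.size ∧
      stripZeros.Runs ctl₀
        { e with res := (num n ++ List.replicate j (some false)).reverse, c := [] }.stk ctl₀
        { e with res := l₂, c := l₁ }.stk (j + 1) := by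
    induction j with
    | zero =>
      by_cases h0 : n = 0
      · refine ⟨[], [], by simp [h0], by simp, Prog.Runs.block_exit ?_⟩
        simp [h0, Env.stk, Env.set, ctl₀]
      · obtain ⟨l, hl⟩ := exists_num_eq h0
        refine ⟨[some true], l.reverse, by simp [hl], ?_, Prog.Runs.block_exit ?_⟩
        · have := congrArg List.length hl
          rw [length_num] at this
          simp at this ⊢
          omega
        · simp [hl, Env.stk, Env.set, ctl₀, Ctl.reset]
    | succ j ih =>
      obtain ⟨l₁, l₂, h, hle, hr⟩ := ih
      refine ⟨l₁, l₂, h, hle, Prog.Runs.block_step ?_ hr⟩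
      have hrep : (num n ++ List.replicate (j + 1) (some false)).reverse =
          some false :: (num n ++ List.replicate j (some false)).reverse := by
        rw [List.replicate_succ', ← List.append_assoc, List.reverse_append]
        rfl
      simp [hrep, Env.stk, Env.set, ctl₀, Ctl.reset]
  obtain ⟨l₁, l₂, h, hle, hr⟩ := h1
  have h2 := runs_move (G := G) (a := .res) (b := .c) (by decide) { e with res := l₂, c := l₁ }
  simp only [Env.get, Env.stk, Env.set, h] at h2
  exact (Prog.Runs.seq hr h2).mono (by omega)

/-! ### The next stage -/

/-- Adds the number `0` to the table `d`. -/
def pushZero : Pr G := .block [.push (.own .d) (fun _ => none) <| .goto fun _ => false]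

theorem exec_pushZero (e : Env G) : Exec pushZero e { e with d := none :: e.d } 1 := by
  refine Prog.Runs.block_exit ?_
  simp [Env.stk, Env.set]

/-- Computes the tables of the next stage. -/
def advance : Pr G :=
  pushZero.seq <| sumTable.seq <| (move .out .d).seq <| (clear .c).seq <| select.seq <|
    sub.seq <| strip.seq (move .pb .pl)

theorem exec_advance (ns : List ℕ) (s : List ℕ × ℕ) (a ℓ : ℕ)
    (hns : ∀ m ∈ ns, m.size ≤ ℓ) (hb : (nextBase s).size ≤ ℓ)
    (ha : ns.find? (fun a => decide ((nextBase s).size < a.size ∧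
      a.size ≤ (nextBase s).size + G.κ)) = some a) (e : Env G) :
    Exec advance
      { e with pl := printed ns, c := num s.2, d := nums s.1, aux := [], pb := [], cur := [],
               acc := [], out := [], res := [] }
      { e with pl := printed ns, c := num (a - nextBase s),
               d := nums (runningSums s.2 0 (0 :: s.1)), aux := [], pb := [], cur := [],
               acc := [], out := [], res := [] }
      ((s.1.length + ns.length + 4) * (4 * ℓ + 5)) := by
  obtain ⟨l, c⟩ := s
  have hbase : nextBase (l, c) = 0 + (0 :: l).sum + c * (0 :: l).length := by simp [nextBase]
  set b := nextBase (l, c) with hb'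
  dsimp only
  have hc : c.size ≤ ℓ := by
    refine (Nat.size_le_size ?_).trans hb
    simp only [hb', nextBase]
    exact (Nat.le_mul_of_pos_right c (Nat.succ_pos _)).trans (Nat.le_add_left _ _)
  have hat : b.size < a.size := by simpa using And.left (by simpa using List.find?_some ha)
  have haℓ : a.size ≤ ℓ := hns a (List.mem_of_find?_eq_some ha)
  have hba : b ≤ a := by
    by_contra hlt
    exact absurd (Nat.size_le_size (not_le.mp hlt).le) (not_le.mpr hat)
  have hsums : ∀ n ∈ runningSums c 0 (0 :: l), n.size ≤ ℓ := fun n hn =>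
    (Nat.size_le_size (hbase ▸ mem_runningSums_le hn)).trans hb
  have hlen := length_nums_le hsums
  rw [length_runningSums] at hlen
  have hplen := length_printed_le hns
  obtain ⟨l₁, l₂, hl, h5⟩ := exec_select (G := G) b a ℓ hb ns hns ha
    { e with c := [], d := nums (runningSums c 0 (0 :: l)), out := [], res := [] }
  obtain ⟨j, hj, h6⟩ := runs_sub (G := G) a b false (by simpa using hba)
    { e with c := [], d := nums (runningSums c 0 (0 :: l)), out := [], res := [], pl := l₂,
             pb := l₁, aux := [] }
  have h1 := exec_pushZero { e with
    pl := printed ns, c := num c, d := nums l, aux := [], pb := [], cur := [], acc := [],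
    out := [], res := [] }
  have h2 := exec_sumTable c ℓ (0 :: l) 0 { e with pl := printed ns, pb := [], cur := [], out := [] }
    (by rwa [← hbase])
  have h3 := runs_move (G := G) (a := .out) (b := .d) (by decide) { e with
    pl := printed ns, c := num c, d := [], aux := [], pb := [], cur := [], acc := num b,
    out := (nums (runningSums c 0 (0 :: l))).reverse, res := [] }
  have h4 := runs_clear (G := G) .c { e with
    pl := printed ns, c := num c, d := nums (runningSums c 0 (0 :: l)), aux := [], pb := [],
    cur := [], acc := num b, out := [], res := [] }
  have h7 := exec_strip (G := G) (a - b) j { e with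
    d := nums (runningSums c 0 (0 :: l)), out := [], pl := l₂, pb := l₁, aux := [], cur := [],
    acc := [] }
  have h8 := runs_move (G := G) (a := .pb) (b := .pl) (by decide) { e with
    d := nums (runningSums c 0 (0 :: l)), c := num (a - b), out := [], pl := l₂, pb := l₁,
    aux := [], cur := [], acc := [], res := [] }
  have hl₁ : l₁.length ≤ (printed ns).length := by rw [← hl]; simp
  rw [← hbase] at h2
  simp only [Env.get, Env.stk, Env.set, List.reverse_reverse, List.append_nil, hl,
    List.length_reverse, length_num, Bool.toNat_false, Nat.sub_zero, nums_cons, num_zero,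
    List.nil_append, List.length_cons] at h1 h2 h3 h4 h6 h7 h8 hj hlen
  refine Exec.mono (h1.seq <| h2.seq <| h3.seq <| h4.seq <| h5.seq <| Exec.seq h6 <| h7.seq h8) ?_
  simp only [Nat.add_mul, Nat.mul_add] at hlen hplen ⊢
  ring_nf at hlen hplen ⊢
  omega

theorem Prog.Counts.of_relabel {K : Type} [DecidableEq K] {Γ : K → Type} {σ Λ : Type}
    {P : Prog Γ σ} {A : σ → Bool} {Φ : σ → (∀ k, List (Γ k)) → ℕ → ℕ → Prop}
    {f : Λ → Option P.L} {q : Stmt Γ Λ σ} {v v' : σ} {S S' : ∀ k, List (Γ k)} {o : Option Λ}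
    {t n : ℕ} (hq : stepAux q v S = ⟨o, v', S'⟩) (h : P.Counts A Φ ⟨o.map f, v', S'⟩ t n) :
    P.Counts A Φ (stepAux (relabel f q) v S) t n := by
  rw [stepAux_relabel, hq]
  exact h

/-! ### Branching into a given number of accepting paths -/

/-- Stops with as many accepting paths as the number on `c` says: a number `2 * n + b` is treated by
continuing with `n` in two ways, and by accepting at once if `b = 1`. -/
def branchOut : Pr G :=
  let skip : St G := .pop (.own .c) (fun v s => { v with r := s }) <|
    .branch (fun v => v.r.isSome) (.load Ctl.reset <| .goto fun _ => true) .halt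
  .block [skip, skip, .pop (.own .c) (fun v s => { v with accept := Ctl.bit s == 1 }) .halt]

theorem counts_branchOut (Φ) (n : ℕ) (e : Env G) :
    branchOut.CountsFrom Ctl.accept Φ ctl₀ { e with c := num n }.stk (n.size + 1) n := by
  induction n using Nat.strong_induction_on with
  | _ n ih =>
  by_cases h0 : n = 0
  · subst h0
    refine Prog.Counts.step_three (P := branchOut) (n₁ := 0) (n₂ := 0) (n₃ := 0) rfl ?_ ?_ ?_
    · refine Prog.Counts.of_relabel (o := none) (v' := ctl₀) (S' := { e with c := num 0 }.stk) ?_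
        (.halt (v := ctl₀))
      simp [Env.stk, Env.set, ctl₀]
    · refine Prog.Counts.of_relabel (o := none) (v' := ctl₀) (S' := { e with c := num 0 }.stk) ?_
        (.halt (v := ctl₀))
      simp [Env.stk, Env.set, ctl₀]
    · refine Prog.Counts.of_relabel (o := none) (v' := ctl₀) (S' := { e with c := num 0 }.stk) ?_
        (.halt (v := ctl₀))
      simp [Env.stk, Env.set, ctl₀]
  · have hs : (digit? n).isSome = true := by simp [digit?, h0]
    have hn : n = n / 2 + n / 2 + n.bodd.toNat := by
      have := bodd_toNat_add n
      omega
    rw [size_div_two h0]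
    conv => arg 7; rw [hn]
    refine Prog.Counts.step_three (P := branchOut) rfl ?_ ?_ ?_
    · refine Prog.Counts.of_relabel (o := some true) (v' := ctl₀) ?_ (ih (n / 2) (by omega))
      simp [Env.stk, Env.set, ctl₀, head?_num, tail_num, hs, Ctl.reset]
    · refine Prog.Counts.of_relabel (o := some true) (v' := ctl₀) ?_ (ih (n / 2) (by omega))
      simp [Env.stk, Env.set, ctl₀, head?_num, tail_num, hs, Ctl.reset]
    · refine Prog.Counts.of_relabel (o := none) (v' := { ctl₀ with accept := n.bodd })
        (S' := { e with c := num (n / 2) }.stk) ?_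
        (.mono (.halt (v := { ctl₀ with accept := n.bodd })) (Nat.zero_le _))
      simp [Env.stk, Env.set, ctl₀, head?_num, tail_num]

/-! ### Guessing an accepting path -/

/-- A statement of the simulated machine, as a statement of the counting machine. -/
def embedSim : Stmt G.N.Γ G.N.Λ G.N.σ → Stmt (K := StkIdx G) StkIdx.Γ (Option G.N.Λ) (Ctl G)
  | .push k g q => .push (.sim k) (fun v => g v.nv) (embedSim q)
  | .peek k g q => .peek (.sim k) (fun v s => { v with nv := g v.nv s }) (embedSim q)
  | .pop k g q => .pop (.sim k) (fun v s => { v with nv := g v.nv s }) (embedSim q)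
  | .load g q => .load (fun v => { v with nv := g v.nv }) (embedSim q)
  | .branch g q₁ q₂ => .branch (fun v => g v.nv) (embedSim q₁) (embedSim q₂)
  | .goto l => .goto fun v => some (l v.nv)
  | .halt => .goto fun _ => none

theorem stepAux_embedSim (q : Stmt G.N.Γ G.N.Λ G.N.σ) (v : Ctl G) (e : Env G) :
    stepAux (embedSim q) v e.stk = ⟨some (stepAux q v.nv e.sim).l,
      { v with nv := (stepAux q v.nv e.sim).var },
      { e with sim := (stepAux q v.nv e.sim).stk }.stk⟩ := by
  induction q generalizing v e with
  | branch g q₁ q₂ ih₁ ih₂ => cases h : g v.nv <;> simp [embedSim, h, ih₁, ih₂]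
  | _ => simp_all [embedSim]

/-- A nondeterministic choice as a symbol of the stacks for paths. -/
def choice (i : ℕ) : Fin (G.B + 1) := Fin.ofNat (G.B + 1) i

theorem val_choice {i : ℕ} (hi : i ≤ G.B) : (choice i : Fin (G.B + 1)).val = i :=
  Nat.mod_eq_of_lt (Nat.lt_succ_of_le hi)

/-- Follows a path of the simulated machine. The choices are compared with those on `prev`, and
saved on `new`. -/
def simulate : Pr G where
  L := G.N.Λ
  entry := G.N.main
  code l := (G.N.m l).mapIdx fun i q =>
    .pop .prev (fun v s => { v with cmp := compareStep v.cmp (s.map Fin.val) i }) <|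
    .push .new (fun _ => choice i) (embedSim q)

theorem NTM.sum_acceptingPaths_halted {N : NTM} {v : N.σ} {S : ∀ k, List (N.Γ k)}
    {F : Finset (List ℕ)} (hF : ∀ w, w ∈ F ↔ ∃ d, N.run w ⟨none, v, S⟩ = some d ∧ d.l = none ∧
      N.accept d.var = true) (h : List ℕ → ℕ) :
    ∑ w ∈ F, h w = if N.accept v then h [] else 0 := by
  have : F = if N.accept v then {[]} else ∅ := by
    ext w
    rw [hF]
    obtain _ | ⟨i, w⟩ := w
    · cases h : N.accept v <;> simp [NTM.run, h]
    · cases h : N.accept v <;> simp [NTM.run_cons_none]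
  rw [this]
  cases h : N.accept v <;> simp

theorem counts_simulate {A : Ctl G → Bool} {Φ : Ctl G → (∀ k : StkIdx G, List k.Γ) → ℕ → ℕ → Prop}
    {t : ℕ} (T : ℕ) (h : List ℕ → ℕ) (c : G.N.Cfg) (F : Finset (List ℕ)) (o : Ordering)
    (prev new : List (Fin (G.B + 1))) (e : Env G)
    (hF : ∀ w, w ∈ F ↔ ∃ d, G.N.run w c = some d ∧ d.l = none ∧ G.N.accept d.var = true)
    (hT : ∀ w, G.N.run w c ≠ none → w.length ≤ T)
    (post : ∀ w d, G.N.run w c = some d → d.l = none →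
      Φ { ctl₀ with nv := d.var, cmp := comparePath o (prev.map Fin.val) w }
        { e with prev := prev.drop w.length, new := (w.map choice).reverse ++ new,
                 sim := d.stk }.stk t (if G.N.accept d.var then h w else 0)) :
    simulate.Counts A Φ ⟨some c.l, { ctl₀ with nv := c.var, cmp := o },
      { e with prev := prev, new := new, sim := c.stk }.stk⟩ (t + T + 1) (∑ w ∈ F, h w) := by
  induction T generalizing h c F o prev new with
  | zero =>
    obtain ⟨_ | l, v, S⟩ := c
    · rw [NTM.sum_acceptingPaths_halted hF]
      exact .mono (.exit (post [] _ rfl rfl)) (by omega)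
    -- There is no path of length `1`, so there is no statement at the label `l`.
    · have hm : (simulate.code l).length = 0 := by
        rw [show (simulate.code l).length = (G.N.m l).length from List.length_mapIdx]
        by_contra h0
        have := hT [0] (by rw [NTM.run_cons (Nat.pos_of_ne_zero h0)]; simp [NTM.run])
        simp at this
      rw [NTM.sum_acceptingPaths hF,
        ← show (simulate.code l).length = (G.N.m l).length from List.length_mapIdx]
      refine Prog.Counts.step (P := simulate) (l := l) _ fun i hi => ?_
      omega
  | succ T ih =>
    obtain ⟨_ | l, v, S⟩ := c
    · rw [NTM.sum_acceptingPaths_halted hF]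
      exact .mono (.exit (post [] _ rfl rfl)) (by omega)
    · rw [NTM.sum_acceptingPaths hF]
      have hlen : (simulate.code l).length = (G.N.m l).length := List.length_mapIdx
      rw [← hlen]
      refine Prog.Counts.step (P := simulate) (l := l) _ fun i hi => ?_
      have hi' : i < (G.N.m l).length := hlen ▸ hi
      have hcode : (simulate.code l)[i] =
          .pop .prev (fun v s => { v with cmp := compareStep v.cmp (s.map Fin.val) i })
            (.push .new (fun _ => choice i) (embedSim (G.N.m l)[i])) :=
        List.getElem_mapIdx
      have := ih (fun w => h (i :: w)) (stepAux (G.N.m l)[i] v S)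
        (F.preimage (List.cons i) List.cons_injective.injOn)
        (compareStep o (prev.head?.map Fin.val) i) prev.tail (choice i :: new)
        (fun w => by rw [Finset.mem_preimage, hF, NTM.run_cons hi'])
        (fun w hw => by
          have := hT (i :: w) (by rwa [NTM.run_cons hi'])
          simpa using this)
        (fun w d hw hd => by
          have := post (i :: w) d (by rwa [NTM.run_cons hi']) hd
          simpa [comparePath] using this)
      have hpop : stepAux (simulate.code l)[i] { ctl₀ with nv := v, cmp := o }
          { e with prev := prev, new := new, sim := S }.stk =
          stepAux (embedSim (G.N.m l)[i])
            { ctl₀ with nv := v, cmp := compareStep o (prev.head?.map Fin.val) i }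
            { e with prev := prev.tail, new := choice i :: new, sim := S }.stk := by
        rw [hcode, ← Env.update_new { e with prev := prev.tail, new := new, sim := S } (choice i :: new),
          ← Env.update_prev { e with prev := prev, new := new, sim := S } prev.tail]
        rfl
      rw [hpop, stepAux_embedSim]
      exact this

/-- Goes on if the simulated machine has accepted by a path greater than the previous one. -/
def checkPath : Pr G :=
  .block [.branch (fun v => G.N.accept v.nv && v.cmp == .gt)
    (.load (fun _ => ctl₀) <| .goto fun _ => false) .halt]

theorem counts_checkPath {Φ} {v : G.N.σ} {o : Ordering} {S : ∀ k : StkIdx G, List k.Γ} {t n : ℕ}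
    (h : G.N.accept v = true → o = .gt → Φ ctl₀ S t n)
    (h' : ¬ (G.N.accept v = true ∧ o = .gt) → n = 0) :
    checkPath.CountsFrom Ctl.accept Φ { ctl₀ with nv := v, cmp := o } S (t + 1) n := by
  refine Prog.Counts.step_one (P := checkPath) rfl ?_
  by_cases hv : G.N.accept v = true ∧ o = .gt
  · obtain ⟨hv, rfl⟩ := hv
    exact Prog.Counts.of_relabel (o := some false) (v' := ctl₀) (S' := S) (by simp [hv])
      (.exit (h hv rfl))
  · refine Prog.Counts.of_relabel (o := none) (v' := { ctl₀ with nv := v, cmp := o }) (S' := S) ?_ ?_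
    · rw [stepAux, cond_eq_ite, if_neg (by simpa using hv)]
      rfl
    · rw [h' hv]
      exact .mono (.halt (v := { ctl₀ with nv := v, cmp := o })) (Nat.zero_le _)

/-- Clear any stack. -/
def erase (k : StkIdx G) : Pr G :=
  .block [.pop k (fun v s => { v with b := s.isSome }) <|
    .branch (fun v => v.b) (.load (fun v => { v with b := false }) <| .goto fun _ => true)
      (.goto fun _ => false)]

theorem runs_erase (k : StkIdx G) (S : ∀ k : StkIdx G, List k.Γ) :
    (erase k).Runs ctl₀ S ctl₀ (Function.update S k []) ((S k).length + 1) := by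
  generalize hl : S k = l
  induction l generalizing S with
  | nil =>
    refine Prog.Runs.block_exit ?_
    simp [hl, ctl₀]
  | cons s l ih =>
    refine Prog.Runs.block_step (v' := ctl₀) (S' := Function.update S k l) ?_ ?_
    · simp [hl, ctl₀]
    · change (erase k).Runs _ _ _ _ _
      simpa using ih (Function.update S k l) (by simp)

/-- Clear stacks of the simulated machine. -/
def clearSim : List G.N.K → Pr G
  | [] => .block [.goto fun _ => false]
  | k :: ks => (erase (.sim k)).seq (clearSim ks)

theorem exec_clearSim (H : ℕ) (ks : List G.N.K) (e : Env G) (h : ∀ k, (e.sim k).length ≤ H) :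
    Exec (clearSim ks) e { e with sim := fun k => if k ∈ ks then [] else e.sim k }
      (ks.length * (H + 1) + 1) := by
  induction ks generalizing e with
  | nil =>
    refine (Prog.Runs.block_exit ?_).mono (Nat.le_add_left _ _)
    simp
  | cons k ks ih =>
    have h1 := runs_erase (.sim k) e.stk
    rw [Env.update_sim] at h1
    have h2 := ih { e with sim := Function.update e.sim k [] } fun j => by
      by_cases hj : j = k
      · subst hj; simp
      · simpa [Function.update_of_ne hj] using h j
    have h3 := Exec.seq h1 h2
    have h4 : (fun j => if j ∈ ks then [] else Function.update e.sim k [] j) =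
        fun j => if j ∈ k :: ks then [] else e.sim j := by
      funext j
      by_cases hj : j = k
      · subst hj; simp
      · simp [hj]
    rw [h4] at h3
    refine h3.mono ?_
    have := h k
    rw [List.length_cons, Nat.add_mul]
    simp only [Env.stk]
    omega

/-- Move the path on `new` to `prev`. -/
def movePath : Pr G :=
  .block [.pop .new (fun v s => { v with p := s }) <|
    .branch (fun v => v.p.isSome)
      (.push .prev (fun v => v.p.getD 0) <| .load (fun v => { v with p := none }) <|
        .goto fun _ => true)
      (.goto fun _ => false)]

/-- Replace the path on `prev` by the one on `new`. -/
def savePath : Pr G := (erase .prev).seq movePath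

theorem exec_savePath (e : Env G) :
    Exec savePath e { e with prev := e.new.reverse, new := [] }
      (e.prev.length + e.new.length + 2) := by
  suffices H : ∀ l p, Exec movePath
        { e with prev := p, new := l }
        { e with prev := l.reverse ++ p, new := [] } (l.length + 1) by
    have h1 := runs_erase .prev e.stk
    rw [Env.update_prev] at h1
    have := Exec.seq h1 (H e.new [])
    simp only [List.append_nil] at this
    refine this.mono ?_
    simp only [Env.stk]
    omega
  intro l
  induction l with
  | nil =>
    intro p
    refine Prog.Runs.block_exit ?_
    simp [Env.stk, ctl₀]
  | cons s l ih =>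
    intro p
    refine Prog.Runs.block_step (v' := ctl₀) (S' := { e with prev := s :: p, new := l }.stk) ?_ ?_
    · simp [Env.stk, ctl₀]
    · have := ih (s :: p)
      rw [List.reverse_cons, List.append_assoc]
      exact this

/-- Move the input from `aux` to `inp` and, at the same time, to the input stack of the simulated
machine. -/
def copyInput : Pr G :=
  .block [.pop (.own .aux) (fun v s => { v with r := s }) <|
    .branch (fun v => v.r.isSome)
      (.push (.own .inp) (fun v => v.r.getD none) <|
        .push (.sim G.N.k₀) (fun v => G.N.inputSymbol ((v.r.getD none).getD false)) <|
        .load (fun v => { v with r := none }) <| .goto fun _ => true)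
      (.goto fun _ => false)]

/-- Write the input on the input stack of the simulated machine. -/
def loadSim : Pr G := (move .inp .aux).seq copyInput

theorem exec_loadSim (x : List Bool) (e : Env G) :
    Exec loadSim { e with inp := x.map some, aux := [], sim := fun _ => [] }
      { e with inp := x.map some, aux := [], sim := (G.N.init x).stk } (2 * x.length + 2) := by
  suffices H : ∀ l y : List Bool, Exec copyInput
        { e with inp := y.map some, aux := l.map some, sim := (G.N.init y).stk }
        { e with inp := (l.reverse ++ y).map some, aux := [],
                 sim := (G.N.init (l.reverse ++ y)).stk } (l.length + 1) by
    have h1 := runs_move (G := G) (a := .inp) (b := .aux) (by decide)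
      { e with inp := x.map some, aux := [], sim := fun _ => [] }
    have h2 := H x.reverse []
    have h3 : (G.N.init []).stk = fun _ => [] := by
      simp [NTM.init]
    simp only [Env.get, Env.stk, Env.set, List.append_nil, List.length_map, List.map_nil, h3,
      List.map_reverse, List.reverse_reverse, List.length_reverse] at h1 h2
    exact (Exec.seq h1 h2).mono (by omega)
  intro l
  induction l with
  | nil =>
    intro y
    refine Prog.Runs.block_exit ?_
    simp [Env.stk, Env.set, ctl₀]
  | cons s l ih =>
    intro y
    refine Prog.Runs.block_step (v' := ctl₀) (S' := { e with
      inp := (s :: y).map some, aux := l.map some, sim := (G.N.init (s :: y)).stk }.stk) ?_ ?_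
    · simp [Env.stk, Env.set, ctl₀, NTM.init]
    · have := ih (s :: y)
      rw [List.reverse_cons, List.append_assoc]
      exact this

theorem NTM.le_of_mem_run {N : NTM} {B : ℕ} (hB : ∀ l, (N.m l).length ≤ B) {w : List ℕ}
    {c d : N.Cfg} (h : N.run w c = some d) : ∀ i ∈ w, i ≤ B := by
  induction w generalizing c with
  | nil => simp
  | cons i w ih =>
    obtain ⟨_ | l, v, S⟩ := c
    · rw [run_cons_none] at h; cases h
    · by_cases hi : i < (N.m l).length
      · rw [run_cons hi] at h
        exact List.forall_mem_cons.mpr ⟨(hi.trans_le (hB l)).le, ih h⟩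
      · rw [run_cons_of_le (not_lt.mp hi)] at h; cases h

/-- Guess an accepting path of the simulated machine that is greater than the one on `prev`, and
put it there. -/
noncomputable def guess : Pr G :=
  loadSim.seq <| simulate.seq <| checkPath.seq <|
    (clearSim (letI := Fintype.ofFinite G.N.K; Finset.univ.toList)).seq savePath

/-- A time bound for `guess` on inputs of length `n`, if the simulated machine takes at most `T`
steps, each of which pushes at most `C` symbols. -/
noncomputable def guessTime (G : Setup) (C n T : ℕ) : ℕ :=
  (2 * n + 2) + (T + 1) + 1 + (Nat.card G.N.K * (n + C * T + 1) + 1) + (2 * T + 2)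

theorem counts_guess {Φ : Ctl G → (∀ k : StkIdx G, List k.Γ) → ℕ → ℕ → Prop} {t C T : ℕ}
    {x : List Bool} (hB : ∀ l, (G.N.m l).length ≤ G.B)
    (hC : ∀ l, ∀ q ∈ G.N.m l, pushBound q ≤ C)
    (hT : ∀ w, G.N.run w (G.N.init x) ≠ none → w.length ≤ T) {F : Finset (List ℕ)}
    (hF : ∀ w, w ∈ F ↔ G.N.IsAcceptingPath x w) (g : List ℕ → ℕ) {p : List ℕ}
    (hp : p.length ≤ T) (hpB : ∀ i ∈ p, i ≤ G.B) (e : Env G)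
    (post : ∀ w ∈ F, p < w → (∀ i ∈ w, i ≤ G.B) → w.length ≤ T →
      Φ ctl₀ { e with inp := x.map some, aux := [], sim := fun _ => [], new := [],
                      prev := w.map choice }.stk t (g w)) :
    guess.CountsFrom Ctl.accept Φ ctl₀ { e with
      inp := x.map some, aux := [], sim := fun _ => [], new := [], prev := p.map choice }.stk
      (t + guessTime G C x.length T) (∑ w ∈ F.filter (p < ·), g w) := by
  have hval : (p.map choice).map (Fin.val (n := G.B + 1)) = p := by
    rw [List.map_map]
    exact (List.map_congr_left fun i hi => val_choice (hpB i hi)).trans (List.map_id _)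
  rw [Finset.sum_filter]
  refine .mono ((exec_loadSim x { e with new := [], prev := p.map choice }).countsFrom_seq
    (T := 2 * x.length + 2) (t := t + (Nat.card G.N.K * (x.length + C * T + 1) + 1) + (2 * T + 2)
      + 1 + T + 1) ?_) (by rw [guessTime]; omega)
  refine Prog.CountsFrom.seq ?_
  refine counts_simulate T _ (G.N.init x) F .eq (p.map choice) []
    { e with inp := x.map some, aux := [] } hF hT fun w d hw hd => ?_
  rw [hval]
  refine Prog.CountsFrom.seq (counts_checkPath ?_ ?_)
  · intro ha hgt
    rw [comparePath_eq_gt_iff] at hgt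
    have hwT : w.length ≤ T := hT w (by simp [hw])
    have hwF : w ∈ F := (hF w).mpr ⟨d, hw, hd, ha⟩
    have hwB : ∀ i ∈ w, i ≤ G.B := NTM.le_of_mem_run hB hw
    rw [if_pos ha, if_pos hgt]
    have h1 := exec_clearSim (x.length + C * T)
      (letI := Fintype.ofFinite G.N.K; Finset.univ.toList : List G.N.K)
      { e with inp := x.map some, aux := [], prev := (p.map choice).drop w.length,
               new := (w.map choice).reverse, sim := d.stk } fun k => by
        refine (NTM.length_run_le hC hw k).trans (add_le_add ?_ (Nat.mul_le_mul_left _ hwT))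
        by_cases hk : k = G.N.k₀
        · subst hk; simp [NTM.init]
        · simp [NTM.init, Function.update_of_ne hk]
    have h2 := Exec.seq h1 (exec_savePath _)
    simp only [Finset.mem_toList, Finset.mem_univ, if_true, List.reverse_reverse] at h2
    rw [List.append_nil]
    refine Prog.Counts.mono (h2 Ctl.accept Φ t _ (post w hwF hgt hwB hwT)) ?_
    simp only [List.length_reverse, List.length_map, List.length_drop, Finset.length_toList,
      Finset.card_univ, ← Nat.card_eq_fintype_card]
    omega
  · intro h
    by_cases ha : G.N.accept d.var = true
    · rw [if_pos ha, if_neg]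
      intro hgt
      exact h ⟨ha, (comparePath_eq_gt_iff _ _).mpr hgt⟩
    · rw [if_neg ha]

open Polynomial

/-! ### Computing a polynomial in unary -/

/-- A number in unary. -/
def unary (n : ℕ) : List (Option Bool) := List.replicate n (some false)

/-- Pushes `a` symbols on `cur`, then leaves. -/
def pushUnary : ℕ → St G
  | 0 => .goto fun _ => false
  | a + 1 => .push (.own .cur) (fun _ => some false) (pushUnary a)

/-- Adds the constant `a` to the unary number on `cur`. -/
def addConst (a : ℕ) : Pr G := .block [pushUnary a]

theorem exec_addConst (a n : ℕ) (e : Env G) :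
    Exec (addConst a) { e with cur := unary n } { e with cur := unary (n + a) } 1 := by
  refine Prog.Runs.block_exit ?_
  induction a generalizing n with
  | zero => simp [pushUnary]
  | succ a ih =>
    have := ih (n + 1)
    rw [show n + (a + 1) = n + 1 + a by omega]
    simpa [pushUnary, Env.get, Env.stk, Env.set, unary, List.replicate_succ] using this

/-- Moves the input from `inp` to `aux` and adds its length to the unary number on `res`. -/
def addLength : Pr G :=
  .block [.pop (.own .inp) (fun v s => { v with r := s }) <|
    .branch (fun v => v.r.isSome)
      (.push (.own .aux) (fun v => v.r.getD none) <| .push (.own .res) (fun _ => some false) <|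
        .load (fun v => { v with r := none }) <| .goto fun _ => true)
      (.goto fun _ => false)]

theorem exec_addLength (l a : List (Option Bool)) (n : ℕ) (e : Env G) :
    Exec addLength { e with inp := l, aux := a, res := unary n }
      { e with inp := [], aux := l.reverse ++ a, res := unary (n + l.length) } (l.length + 1) := by
  induction l generalizing a n with
  | nil =>
    refine Prog.Runs.block_exit ?_
    simp [Env.stk, Env.set, ctl₀]
  | cons s l ih =>
    refine Prog.Runs.block_step (v' := ctl₀)
      (S' := { e with inp := l, aux := s :: a, res := unary (n + 1) }.stk) ?_ ?_
    · simp [Env.stk, Env.set, ctl₀, unary, List.replicate_succ]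
    · have := ih (s :: a) (n + 1)
      rw [List.reverse_cons, List.append_assoc, List.length_cons,
        show n + (l.length + 1) = n + 1 + l.length by omega]
      exact this

/-- Removes the top symbol of `cur`. -/
def popCur : Pr G := .block [.pop (.own .cur) (fun v _ => v) <| .goto fun _ => false]

theorem exec_popCur (e : Env G) : Exec popCur e { e with cur := e.cur.tail } 1 := by
  refine Prog.Runs.block_exit ?_
  simp [Env.stk, Env.set]

/-- Multiplies the unary number on `cur` by the length of the input. -/
def mulLength : Pr G :=
  (whileNonempty .cur (popCur.seq (addLength.seq (move .aux .inp)))).seq (move .res .cur)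

theorem exec_mulLength (x : List (Option Bool)) (n : ℕ) (e : Env G) :
    Exec mulLength { e with inp := x, aux := [], cur := unary n, res := [] }
      { e with inp := x, aux := [], cur := unary (n * x.length), res := [] }
      (n * (3 * x.length + 4) + 2) := by
  have H : ∀ m, Exec (whileNonempty .cur (popCur.seq (addLength.seq (move .aux .inp))))
      { e with inp := x, aux := [], cur := unary n, res := unary m }
      { e with inp := x, aux := [], cur := [], res := unary (m + n * x.length) }
      (n * (2 * x.length + 4) + 1) := by
    induction n with
    | zero =>
      intro m
      simpa [unary] using exec_whileNonempty_nil (G := G) (a := .cur)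
        (P := popCur.seq (addLength.seq (move .aux .inp)))
        (e := { e with inp := x, aux := [], cur := [], res := unary m }) rfl
    | succ n ih =>
      intro m
      have h1 := exec_popCur { e with inp := x, aux := [], cur := unary (n + 1), res := unary m }
      have h2 := exec_addLength x [] m { e with cur := unary n }
      have h3 := runs_move (G := G) (a := .aux) (b := .inp) (by decide) { e with
        inp := [], aux := x.reverse, cur := unary n, res := unary (m + x.length) }
      have h4 := ih (m + x.length)
      rw [show (unary (n + 1)).tail = unary n by simp [unary, List.replicate_succ]] at h1
      simp only [Env.get, Env.stk, Env.set, List.reverse_reverse, List.append_nil,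
        List.length_reverse] at h1 h2 h3
      rw [show m + (n + 1) * x.length = m + x.length + n * x.length by ring]
      refine (Exec.whileNonempty (a := .cur) (by simp [Env.get, Env.stk, unary])
        (h1.seq (Exec.seq h2 h3)) h4).mono ?_
      simp only [Nat.add_mul]
      omega
  have h1 := H 0
  have h2 := runs_move (G := G) (a := .res) (b := .cur) (by decide) { e with
    inp := x, aux := [], cur := [], res := unary (n * x.length) }
  rw [Nat.zero_add] at h1
  simp only [Env.get, Env.stk, Env.set, List.append_nil] at h2
  rw [show (unary (n * x.length)).reverse = unary (n * x.length) by simp [unary]] at h2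
  refine (Exec.seq h1 h2).mono ?_
  simp only [unary, List.length_replicate, Nat.mul_add]
  ring_nf
  omega

/-- A polynomial of the length of the input can be computed in unary, in polynomial time. -/
theorem exists_exec_unary (G : Setup) (p : ℕ[X]) : ∃ (P : Pr G) (T : ℕ[X]),
    ∀ (x : List (Option Bool)) (e : Env G),
      Exec P { e with inp := x, aux := [], cur := [], res := [] }
        { e with inp := x, aux := [], cur := unary (p.eval x.length), res := [] }
        (T.eval x.length) := by
  induction p using Polynomial.recOnHorner with
  | M0 =>
    refine ⟨addConst 0, 1, fun x e => ?_⟩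
    simpa [unary] using exec_addConst 0 0 { e with inp := x, aux := [], res := [] }
  | MC p a _ _ ih =>
    obtain ⟨P, T, h⟩ := ih
    refine ⟨P.seq (addConst a), T + 1, fun x e => ?_⟩
    have := (h x e).seq (exec_addConst a _ { e with inp := x, aux := [], res := [] })
    simpa using this
  | MX p _ ih =>
    obtain ⟨P, T, h⟩ := ih
    refine ⟨P.seq mulLength, T + (p * (3 * X + 4) + 2), fun x e => ?_⟩
    have := (h x e).seq (exec_mulLength x _ e)
    simpa using this

/-! ### Running the printer -/

/-- Moves the unary number on `cur` to the input stack of the printer. -/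
def loadPrinter : Pr G :=
  .block [.pop (.own .cur) (fun v s => { v with r := s }) <|
    .branch (fun v => v.r.isSome)
      (.push (.print G.M.k₀) (fun _ => G.zero) <|
        .load (fun v => { v with r := none }) <| .goto fun _ => true)
      (.goto fun _ => false)]

theorem exec_loadPrinter (n : ℕ) (e : Env G) :
    Exec loadPrinter { e with cur := unary n, print := fun _ => [] }
      { e with cur := [], print := Function.update (fun _ => []) G.M.k₀ (List.replicate n G.zero) }
      (n + 1) := by
  suffices H : ∀ m, Exec loadPrinter
      { e with cur := unary n,
               print := Function.update (fun _ => []) G.M.k₀ (List.replicate m G.zero) }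
      { e with cur := [],
               print := Function.update (fun _ => []) G.M.k₀ (List.replicate (m + n) G.zero) }
      (n + 1) by
    simpa using H 0
  induction n with
  | zero =>
    intro m
    refine Prog.Runs.block_exit ?_
    simp [Env.stk, Env.set, ctl₀, unary]
  | succ n ih =>
    intro m
    refine Prog.Runs.block_step (v' := ctl₀) (S' := { e with
      cur := unary n
      print := Function.update (fun _ => []) G.M.k₀ (List.replicate (m + 1) G.zero) }.stk) ?_ ?_
    · simp [Env.stk, Env.set, ctl₀, unary, List.replicate_succ]
    · rw [show m + (n + 1) = m + 1 + n by omega]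
      exact ih (m + 1)

/-- A statement of the printer, as a statement of the counting machine. -/
def embedPrint : Stmt G.M.Γ G.M.Λ G.M.σ → Stmt (K := StkIdx G) StkIdx.Γ (Option G.M.Λ) (Ctl G)
  | .push k g q => .push (.print k) (fun v => g v.mv) (embedPrint q)
  | .peek k g q => .peek (.print k) (fun v s => { v with mv := g v.mv s }) (embedPrint q)
  | .pop k g q => .pop (.print k) (fun v s => { v with mv := g v.mv s }) (embedPrint q)
  | .load g q => .load (fun v => { v with mv := g v.mv }) (embedPrint q)
  | .branch g q₁ q₂ => .branch (fun v => g v.mv) (embedPrint q₁) (embedPrint q₂)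
  | .goto l => .goto fun v => some (l v.mv)
  | .halt => .goto fun _ => none

theorem stepAux_embedPrint (q : Stmt G.M.Γ G.M.Λ G.M.σ) (v : Ctl G) (e : Env G) :
    stepAux (embedPrint q) v e.stk = ⟨some (stepAux q v.mv e.print).l,
      { v with mv := (stepAux q v.mv e.print).var },
      { e with print := (stepAux q v.mv e.print).stk }.stk⟩ := by
  induction q generalizing v e with
  | branch g q₁ q₂ ih₁ ih₂ => cases h : g v.mv <;> simp [embedPrint, h, ih₁, ih₂]
  | _ => simp_all [embedPrint]

/-- Run the printer. -/
def runPrinter : Pr G where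
  L := G.M.Λ
  entry := G.M.main
  code l := [embedPrint (G.M.m l)]

theorem iterate_bind_none {α : Type*} (f : α → Option α) (n : ℕ) :
    (flip bind f)^[n] none = none := by
  induction n with
  | zero => rfl
  | succ n ih => rw [Function.iterate_succ_apply]; exact ih

theorem counts_runPrinter {A : Ctl G → Bool}
    {Φ : Ctl G → (∀ k : StkIdx G, List k.Γ) → ℕ → ℕ → Prop} {t m : ℕ} (n : ℕ)
    (c d : Cfg G.M.Γ G.M.Λ G.M.σ) (e : Env G) (hn : (flip bind (step G.M.m))^[n] (some c) = some d)
    (hd : d.l = none) (h : Φ { ctl₀ with mv := d.var } { e with print := d.stk }.stk t m) :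
    runPrinter.Counts A Φ ⟨some c.l, { ctl₀ with mv := c.var }, { e with print := c.stk }.stk⟩
      (t + n) m := by
  induction n generalizing c with
  | zero =>
    obtain rfl : c = d := by simpa using hn
    rw [hd]
    exact .exit h
  | succ n ih =>
    rw [Function.iterate_succ_apply] at hn
    obtain ⟨_ | l, v, S⟩ := c
    · have : (flip bind (step G.M.m)) (some ⟨none, v, S⟩) = none := rfl
      rw [this, iterate_bind_none] at hn
      cases hn
    · have := ih (stepAux (G.M.m l) v S) hn
      have hq := stepAux_embedPrint (G.M.m l) { ctl₀ with mv := v } { e with print := S }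
      exact Prog.Counts.step_one (P := runPrinter) (l := l) rfl
        ((congrArg (fun c => runPrinter.Counts A Φ c (t + n) m) hq).mpr this)

theorem length_iterate_step_le {C : ℕ} (hC : ∀ l, pushBound (G.M.m l) ≤ C) (n : ℕ)
    (c d : Cfg G.M.Γ G.M.Λ G.M.σ) (hn : (flip bind (step G.M.m))^[n] (some c) = some d)
    (k : G.M.K) : (d.stk k).length ≤ (c.stk k).length + C * n := by
  induction n generalizing c with
  | zero =>
    obtain rfl : c = d := by simpa using hn
    simp
  | succ n ih =>
    rw [Function.iterate_succ_apply] at hn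
    obtain ⟨_ | l, v, S⟩ := c
    · have : (flip bind (step G.M.m)) (some ⟨none, v, S⟩) = none := rfl
      rw [this, iterate_bind_none] at hn
      cases hn
    · have h1 := ih (stepAux (G.M.m l) v S) hn
      have h2 := length_stepAux_le (G.M.m l) v S k
      have h3 := hC l
      rw [Nat.mul_add]
      dsimp only
      omega

theorem stk_initList (M : FinTM2) (s : List (M.Γ M.k₀)) :
    (initList M s).stk = Function.update (fun _ => []) M.k₀ s := by
  funext k
  by_cases h : k = M.k₀
  · subst h; simp [initList]
  · simp [initList, h]

theorem stk_haltList (M : FinTM2) (s : List (M.Γ M.k₁)) :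
    (haltList M s).stk = Function.update (fun _ => []) M.k₁ s := by
  funext k
  by_cases h : k = M.k₁
  · subst h; simp [haltList]
  · simp [haltList, h]

/-- Moves the output of the printer to `aux`. -/
def readOutput : Pr G :=
  .block [.pop (.print G.M.k₁) (fun v s => { v with r := s.map G.decode }) <|
    .branch (fun v => v.r.isSome)
      (.push (.own .aux) (fun v => v.r.getD none) <| .load (fun v => { v with r := none }) <|
        .goto fun _ => true)
      (.goto fun _ => false)]

theorem exec_readOutput {enc : Option Bool → G.M.Γ G.M.k₁} (henc : ∀ s, G.decode (enc s) = s)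
    (l a : List (Option Bool)) (e : Env G) :
    Exec readOutput { e with aux := a, print := Function.update (fun _ => []) G.M.k₁ (l.map enc) }
      { e with aux := l.reverse ++ a, print := fun _ => [] } (l.length + 1) := by
  induction l generalizing a with
  | nil =>
    refine Prog.Runs.block_exit ?_
    simp [Env.stk, Env.set, ctl₀]
  | cons s l ih =>
    refine Prog.Runs.block_step (v' := ctl₀) (S' := { e with
      aux := s :: a
      print := Function.update (fun _ => []) G.M.k₁ (l.map enc) }.stk) ?_ ?_
    · simp [Env.stk, Env.set, ctl₀, henc]
    · have := ih (s :: a)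
      rw [List.reverse_cons, List.append_assoc]
      exact this

/-- The output of the printer on a unary polynomial of the length of the input can be written on
`pl` in polynomial time. Its length is bounded by a polynomial. -/
theorem exists_exec_print {f : ℕ → List (Option Bool)} {enc : Option Bool → G.M.Γ G.M.k₁}
    (henc : ∀ s, G.decode (enc s) = s) (τ : ℕ[X])
    (hf : ∀ n, Nonempty (TM2OutputsInTime G.M (List.replicate n G.zero) (some ((f n).map enc))
      (τ.eval n))) (p : ℕ[X]) : ∃ (P : Pr G) (T : ℕ[X]),
    ∀ (x : List (Option Bool)) (e : Env G),
      (f (p.eval x.length)).length ≤ T.eval x.length ∧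
      Exec P { e with inp := x, aux := [], pl := [], cur := [], res := [], print := fun _ => [] }
        { e with inp := x, aux := [], pl := f (p.eval x.length), cur := [], res := [],
                 print := fun _ => [] } (T.eval x.length) := by
  obtain ⟨P, T, hP⟩ := exists_exec_unary G p
  obtain ⟨C, hC⟩ := (Set.finite_range fun l => pushBound (G.M.m l)).bddAbove
  have hC : ∀ l, pushBound (G.M.m l) ≤ C := fun l => hC ⟨l, rfl⟩
  refine ⟨P.seq <| loadPrinter.seq <| runPrinter.seq <| readOutput.seq (move .aux .pl),
    T + (p + 1) + τ.comp p + 2 * (p + C * τ.comp p + 1), fun x e => ?_⟩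
  set n := p.eval x.length with hn
  obtain ⟨⟨⟨steps, hsteps⟩, hle⟩⟩ := hf n
  replace hle : steps ≤ τ.eval n := hle
  have hlen : (f n).length ≤ n + C * τ.eval n := by
    have := length_iterate_step_le hC steps (initList G.M (List.replicate n G.zero))
      (haltList G.M ((f n).map enc)) hsteps G.M.k₁
    rw [stk_initList, stk_haltList, Function.update_self, List.length_map] at this
    refine this.trans (add_le_add ?_ (Nat.mul_le_mul_left _ hle))
    by_cases hk : G.M.k₁ = G.M.k₀
    · rw [hk]; simp
    · simp [Function.update_of_ne hk]
  have heval : (T + (p + 1) + τ.comp p + 2 * (p + C * τ.comp p + 1)).eval x.length =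
      T.eval x.length + (n + 1) + τ.eval n + 2 * (n + C * τ.eval n + 1) := by
    simp [hn]
  rw [heval]
  refine ⟨by omega, ?_⟩
  have h1 := hP x { e with pl := [], print := fun _ => [] }
  have h2 := exec_loadPrinter n { e with inp := x, aux := [], pl := [], res := [] }
  have h3 : Exec runPrinter
      { e with inp := x, aux := [], pl := [], cur := [], res := [],
               print := (initList G.M (List.replicate n G.zero)).stk }
      { e with inp := x, aux := [], pl := [], cur := [], res := [],
               print := (haltList G.M ((f n).map enc)).stk } steps := fun A Φ t m hΦ =>
    counts_runPrinter steps (initList G.M (List.replicate n G.zero))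
      (haltList G.M ((f n).map enc))
      { e with inp := x, aux := [], pl := [], cur := [], res := [] } hsteps rfl hΦ
  rw [stk_initList, stk_haltList] at h3
  have h4 := exec_readOutput henc (f n) [] { e with inp := x, pl := [], cur := [], res := [] }
  have h5 := runs_move (G := G) (a := .aux) (b := .pl) (by decide) { e with
    inp := x, aux := (f n).reverse, pl := [], cur := [], res := [], print := fun _ => [] }
  simp only [Env.get, Env.stk, Env.set, List.reverse_reverse, List.append_nil,
    List.length_reverse] at h4 h5
  refine (h1.seq <| Exec.seq h2 <| h3.seq <| Exec.seq h4 h5).mono ?_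
  omega

/-! ### The counting machine -/

/-- Either stop with as many accepting paths as the current coefficient says, or guess one more
accepting path of the simulated machine, compute the next coefficient, and repeat. -/
noncomputable def mainLoop : Pr G :=
  .loop (.goto fun _ => true) (branchOut.choose (guess.seq advance))

/-- The contents of the stacks before the stage `i` of the main loop, on the input `x`, if the
numbers `ns` have been printed and `p` is the path that was guessed last. -/
def stageEnv (x : List Bool) (ns : List ℕ) (i : ℕ) (p : List ℕ) : Env G where
  inp := x.map some
  pl := printed ns
  c := num (stage G.κ ns i).2
  d := nums (stage G.κ ns i).1
  prev := p.map choice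

/-- A time bound for one pass through the main loop. -/
noncomputable def passTime (G : Setup) (C n T q r ℓ : ℕ) : ℕ :=
  (q + r + 4) * (4 * ℓ + 5) + guessTime G C n T + (ℓ + 1) + 2

theorem counts_mainLoop {C T q ℓ : ℕ} {x : List Bool} {ns : List ℕ}
    (hB : ∀ l, (G.N.m l).length ≤ G.B) (hC : ∀ l, ∀ q ∈ G.N.m l, pushBound q ≤ C)
    (hT : ∀ w, G.N.run w (G.N.init x) ≠ none → w.length ≤ T) {F : Finset (List ℕ)}
    (hF : ∀ w, w ∈ F ↔ G.N.IsAcceptingPath x w) (hq : F.card ≤ q)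
    (hns : ∀ n ∈ ns, n.size ≤ ℓ) (hc : ∀ i ≤ q, (coeff G.κ ns i).size ≤ ℓ)
    (hfind : ∀ i < q, ∃ a, ns.find? (fun a => decide
      ((nextBase (stage G.κ ns i)).size < a.size ∧
        a.size ≤ (nextBase (stage G.κ ns i)).size + G.κ)) = some a)
    (m i : ℕ) {p : List ℕ} (hp : p.length ≤ T) (hpB : ∀ i ∈ p, i ≤ G.B)
    (hm : (F.filter (p < ·)).card = m) (hi : i + m ≤ F.card) :
    mainLoop.CountsFrom Ctl.accept (fun _ _ _ _ => False) ctl₀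
      (stageEnv (G := G) x ns i p).stk ((m + 1) * passTime G C x.length T q ns.length ℓ)
      (binomSum (coeff G.κ ns) m i) := by
  induction m using Nat.strong_induction_on generalizing i p with
  | _ m ih =>
  set t := passTime G C x.length T q ns.length ℓ with ht
  -- The path `w` guessed next has some number `j < m` of accepting paths above it, and each `j < m`
  -- occurs once.
  have hsum : binomSum (coeff G.κ ns) m i = coeff G.κ ns i +
      ∑ w ∈ F.filter (p < ·), binomSum (coeff G.κ ns) (F.filter (w < ·)).card (i + 1) := by
    rw [binomSum_eq_add_sum, ← hm, ← sum_card_filter_lt]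
    refine congrArg _ (Finset.sum_congr rfl fun w hw => ?_)
    have hpw := (Finset.mem_filter.mp hw).2
    refine congrArg (fun s : Finset (List ℕ) => binomSum (coeff G.κ ns) s.card (i + 1))
      (Finset.ext fun v => ?_)
    simp only [Finset.mem_filter]
    exact ⟨fun h => ⟨h.1.1, h.2⟩, fun h => ⟨⟨h.1, hpw.trans h.2⟩, h.2⟩⟩
  rw [hsum]
  set ta := (q + ns.length + 4) * (4 * ℓ + 5) with hta
  have hloop := Prog.CountsFrom.loop (P := branchOut.choose (guess.seq advance)) (A := Ctl.accept)
    (Φ := fun _ _ _ _ => False) (q := .goto fun _ => true) (v := ctl₀) (v' := ctl₀)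
    (S := (stageEnv (G := G) x ns i p).stk) rfl
    (Prog.CountsFrom.choose (t := m * t + ta + guessTime G C x.length T + (ℓ + 1))
      (.mono (counts_branchOut _ (coeff G.κ ns i) (stageEnv (G := G) x ns i p)) ?_)
      (.mono (Prog.CountsFrom.seq (counts_guess (t := m * t + ta) hB hC hT hF
        (fun w => binomSum (coeff G.κ ns) (F.filter (w < ·)).card (i + 1)) hp hpB
        (stageEnv (G := G) x ns i p) ?_)) ?_))
  · refine .mono hloop ?_
    have : t = ta + guessTime G C x.length T + (ℓ + 1) + 2 := rfl
    rw [Nat.succ_mul]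
    omega
  · have := hc i (by omega)
    omega
  · intro w hw hpw hwB hwT
    have hlt : (F.filter (w < ·)).card < m := by
      rw [← hm]
      refine Finset.card_lt_card ⟨fun v hv => ?_, fun h => ?_⟩
      · rw [Finset.mem_filter] at hv ⊢
        exact ⟨hv.1, hpw.trans hv.2⟩
      · have := h (Finset.mem_filter.mpr ⟨hw, hpw⟩)
        exact lt_irrefl _ (Finset.mem_filter.mp this).2
    obtain ⟨a, ha⟩ := hfind i (by omega)
    have hsize : (nextBase (stage G.κ ns i)).size < a.size :=
      And.left (by simpa using List.find?_some ha)
    have haℓ := hns a (List.mem_of_find?_eq_some ha)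
    have hadv := exec_advance ns (stage G.κ ns i) a ℓ hns (by omega) ha
      (stageEnv (G := G) x ns i w)
    have hnext : stage G.κ ns (i + 1) = (runningSums (stage G.κ ns i).2 0
        (0 :: (stage G.κ ns i).1), a - nextBase (stage G.κ ns i)) := by
      rw [stage, pick, ha]
      rfl
    have hpost := ih _ hlt (i + 1) hwT hwB rfl (by omega)
    rw [stageEnv, hnext] at hpost
    refine .mono (hadv _ _ _ _ hpost) ?_
    refine add_le_add (Nat.mul_le_mul_right _ hlt) (Nat.mul_le_mul_right _ ?_)
    rw [length_stage]
    omega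
  · omega

/-- The machine that runs `P`, then the main loop. -/
noncomputable def countingMachine (P : Pr G) : NTM :=
  (P.seq mainLoop).toNTM (.own .inp) ⟨some, Option.some_injective _⟩ ctl₀ Ctl.accept

theorem stk_init_countingMachine (P : Pr G) (x : List Bool) :
    ((countingMachine P).init x).stk = ({ inp := x.map some } : Env G).stk := by
  have h : (fun _ => []) = ({} : Env G).stk := by
    funext k
    rcases k with k | _ | _ | k | k
    · cases k <;> rfl
    all_goals rfl
  have := Env.update_own (G := G) {} .inp (x.map some)
  rw [← h] at this
  exact this

theorem hasCount_countingMachine {P : Pr G} {τ C T q ℓ : ℕ} {x : List Bool} {ns : List ℕ}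
    (hP : Exec P { inp := x.map some } { inp := x.map some, pl := printed ns } τ)
    (hB : ∀ l, (G.N.m l).length ≤ G.B) (hC : ∀ l, ∀ q ∈ G.N.m l, pushBound q ≤ C)
    (hN : G.N.PolyTime) (hT : ∀ w, G.N.run w (G.N.init x) ≠ none → w.length ≤ T)
    (hq : G.N.numAcc x ≤ q)
    (hns : ∀ n ∈ ns, n.size ≤ ℓ) (hc : ∀ i ≤ q, (coeff G.κ ns i).size ≤ ℓ)
    (hfind : ∀ i < q, ∃ a, ns.find? (fun a => decide
      ((nextBase (stage G.κ ns i)).size < a.size ∧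
        a.size ≤ (nextBase (stage G.κ ns i)).size + G.κ)) = some a) :
    (countingMachine P).HasCount ((countingMachine P).init x)
      (τ + (q + 1) * passTime G C x.length T q ns.length ℓ)
      (binomSum (coeff G.κ ns) (G.N.numAcc x) 0) := by
  set F := (hN.finite_acceptingPaths x).toFinset with hFdef
  have hF : ∀ w, w ∈ F ↔ G.N.IsAcceptingPath x w := fun w => by simp [hFdef]
  have hcard : F.card = G.N.numAcc x := (Set.ncard_eq_toFinset_card _ _).symm
  have hfilter : F.filter (([] : List ℕ) < ·) = F := by
    refine Finset.filter_true_of_mem fun w hw => ?_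
    obtain _ | ⟨i, w⟩ := w
    -- The machine has not yet halted in its initial configuration.
    · obtain ⟨d, hd, hl, -⟩ := (hF []).mp hw
      cases hd
      cases hl
    · exact List.nil_lt_cons _ _
  have h1 := counts_mainLoop hB hC hT hF (hcard.le.trans hq) hns hc hfind F.card 0 (p := [])
    (by simp) (by simp) (by rw [hfilter]) (by omega)
  have h2 := (hP.countsFrom_seq (Q := mainLoop) h1).hasCount (k₀ := .own .inp)
    (inp := ⟨some, Option.some_injective _⟩) (v₀ := ctl₀)
  rw [← stk_init_countingMachine P x, hcard] at h2
  refine NTM.HasCount.mono h2 ?_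
  rw [add_comm]
  gcongr

end CountingClasses

open CountingClasses Polynomial

theorem theorem2p6 (T : Set ℕ) (hT : ∀ n ∈ T, 0 < n)
    (hS : ∃ S : Set ℕ, S ⊆ T ∧ CountingClasses.NonGappy S ∧
      CountingClasses.PPrintable (CountingClasses.binaryLanguage S)) :
    CountingClasses.FewP ⊆ CountingClasses.RC T := by
  rintro L ⟨N, hpoly, q, hL⟩
  obtain ⟨p, hp⟩ := id hpoly
  obtain ⟨S, hST, hgap, f, hf, M, hM⟩ := hS
  obtain ⟨κ, hκ⟩ := hgap.exists_size fun n hn => hT n (hST hn)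
  obtain ⟨B, hB⟩ := N.exists_length_le
  obtain ⟨C, hC⟩ := N.exists_pushBound
  let G : Setup := { N, M := M.tm, zero := M.inputAlphabet.invFun false,
                     decode := M.outputAlphabet, κ, B, finiteM := hM }
  obtain ⟨P, τ, hP⟩ := exists_exec_print (G := G) (f := fun n => printWords (f n))
    (enc := M.outputAlphabet.invFun) M.outputAlphabet.apply_symm_apply M.time
    (fun n => ⟨by
      have := M.outputsFun n
      rwa [zeros, List.map_replicate, List.length_replicate] at this⟩) (q * (q + (κ : ℕ[X])))
  have key : ∀ x : List Bool, ∃ ns : List ℕ, ns.length ≤ τ.eval x.length ∧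
      (∀ a, a ∈ ns ↔ a ∈ S ∧ a.size ≤ q.eval x.length * (q.eval x.length + κ)) ∧
      (countingMachine P).HasCount ((countingMachine P).init x)
        (τ.eval x.length + (q.eval x.length + 1) * passTime G C x.length (p.eval x.length)
          (q.eval x.length) ns.length (q.eval x.length * (q.eval x.length + κ)))
        (binomSum (coeff κ ns) (N.numAcc x) 0) := by
    intro x
    have hval : (q * (q + (κ : ℕ[X]))).eval x.length =
        q.eval x.length * (q.eval x.length + κ) := by simp
    obtain ⟨ns, hfns, hns⟩ := exists_map_binary
      (hf (q.eval x.length * (q.eval x.length + κ)))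
    obtain ⟨hlen, hrun⟩ := hP (x.map some) {}
    rw [List.length_map, hval, hfns] at hlen hrun
    refine ⟨ns, (length_le_length_printed ns).trans hlen, hns, hasCount_countingMachine (G := G) hrun
      hB hC hpoly (hp x) (hL x).1 (fun n hn => ((hns n).mp hn).2) (fun i hi => ?_) fun i hi => ?_⟩
    · have h1 := (binomSum_coeff_mem hκ hns i hi).1
      have h2 := stage_le κ ns (k := i) List.mem_cons_self
      rw [Nat.zero_add] at h2
      exact (Nat.size_le_size h2).trans (h1.trans (Nat.mul_le_mul_right _ hi))
    · obtain ⟨a, -, -, ha⟩ := (binomSum_coeff_mem hκ hns (i + 1) hi).2 i rfl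
      exact ⟨a, ha⟩
  refine ⟨countingMachine P, ⟨τ + (q + 1) * ((q + τ + 4) * (4 * (q * (q + (κ : ℕ[X]))) + 5) +
    ((2 * X + 2) + (p + 1) + 1 + ((Nat.card N.K : ℕ[X]) * (X + (C : ℕ[X]) * p + 1) + 1) +
      (2 * p + 2)) + (q * (q + (κ : ℕ[X])) + 1) + 2), fun x w hw => ?_⟩, fun x => ?_⟩
  · obtain ⟨ns, hlen, -, h, -⟩ := key x
    refine (h w hw).trans ?_
    simp only [passTime, guessTime, eval_add, eval_mul, eval_X, eval_natCast, eval_ofNat, eval_one,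
      Nat.cast_id]
    gcongr
  · obtain ⟨ns, -, hns, h⟩ := key x
    rw [h.numAcc]
    have hx := (hL x).2
    cases hk : N.numAcc x with
    | zero =>
      rw [hk] at hx
      exact ⟨fun h => absurd (hx.mp h) (lt_irrefl 0), fun _ => rfl⟩
    | succ k =>
      rw [hk] at hx
      obtain ⟨a, haS, ha, -⟩ := (binomSum_coeff_mem hκ hns (k + 1) (hk ▸ (hL x).1)).2 k rfl
      exact ⟨fun _ => ha ▸ hST haS, fun h => absurd (hx.mpr (Nat.succ_pos k)) h⟩
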